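/- Let $(M,g)$ be (an open coordinate domain of) a smooth spacetime of signature $(+,-,-,-)$ that is vacuum with cosmological constant: the trace-free Ricci tensor vanishes and the scalar curvature is $R=24\Lambda$. Let $(l,n,m,\bar m)$ be a smooth null tetrad ($l\cdot n=1=-m\cdot\bar m$, all other products zero), with Newman–Penrose spin coefficients $\kappa,\sigma,\rho,\tau,\epsilon,\gamma,\beta,\alpha,\pi,\nu,\mu,\lambda$ and Weyl scalars $\Psi_0,\dots,\Psi_4$, such that $$K_{\mu\nu}=\lambda_1(n_\mu l_\nu+l_\mu n_\nu)+\lambda_2(m_\mu\bar m_\nu+\bar m_\mu m_\nu)+\lambda_7(m_\mu m_\nu+\bar m_\mu\bar m_\nu)$$ is a Killing tensor, $K_{(\mu\nu;\alpha)}=0$, where $\lambda_1,\lambda_2,\lambda_7$ are smooth real functions and $K^\mu{}_\nu$ has at each point exactly the three distinct eigenvalues $\lambda_1$ (double), $-(\lambda_2+\lambda_7)$, $-(\lambda_2-\lambda_7)$. Suppose that some rotation of the tetrad about $l$, with smooth real parameters $a,b$ and complex parameter $p$, $$\tilde l=e^{a}l,\qquad \tilde m=e^{ib}(m-\bar p\,l),\qquad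 \tilde n=e^{-a}(n+p\bar p\,l-p\,m-\bar p\,\bar m),$$ leaves the tensor $K$ invariant and annihilates the spin coefficients $\tilde\epsilon,\tilde\gamma,\tilde\alpha,\tilde\beta$. Finally let the solution be of Class I: $\rho\neq0=\pi$ everywhere. Then: 1. $p=0$ and $\sin b=0$, so that the rotation is a boost up to the sign of $m$. 2. $\kappa=\nu=0$ (the congruences of $l$ and $n$ are geodesic), $\Psi_1=\Psi_3=0$, $\Psi_2=\Lambda$, $\mu\rho=\sigma\lambda$ and $\mu\tau=0$. 3. At a point near which $\mu=0$: $\lambda=0$, $\Psi_2=\Lambda=0$ and $\Psi_4=0$, and the Petrov type is N unless the Weyl tensor vanishes there. 4. At a point where $\mu\neq0$: $\tau=0$, $\sigma\neq0$ and $\Psi_0\Psi_4=(3\Psi_2)^2$, and the Petrov type is D unless the Weyl tensor vanishes there. 5. At every point where the Weyl tensor does not vanish, the Petrov type is N, or it is D with $\Psi_0\Psi_4=(3\Psi_2)^2$; and $\sigma$ does not vanish identically near that point. Thus the null congruence of $l$ is geodesic ($\kappa=0$), shearing and diverging ($\rho\neq0$). Both types occur: there are such Class I solutions on non-empty open sets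 that are everywhere of Petrov type N, with $\mu=0$, and such Class I solutions that are everywhere of Petrov type D, with $\mu\neq0=\tau$ and $\Psi_0\Psi_4=(3\Psi_2)^2$; in both one can have $\kappa=0$, $\sigma\neq0$ and $\operatorname{Re}\rho\neq0$ everywhere. -/

import Mathlib

open scoped ContDiff Topology

namespace NewmanPenrose

/-- Points of a coordinate domain of spacetime. -/
abbrev Point := Fin 4 → ℝ

/-! ### Calculus with complexified vector fields in coordinates -/

/-- The derivative `v f = vⁱ ∂ᵢ f` of a complex function along a complexified vector `v`. -/
noncomputable def dirDeriv (v : Fin 4 → ℂ) (f : Point → ℂ) (x : Point) : ℂ :=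
  ∑ i, v i * fderiv ℝ f x (Pi.single i 1)

/-- The Lie bracket `[V, W]` of two complexified vector fields. -/
noncomputable def bracket (V W : Point → Fin 4 → ℂ) (x : Point) : Fin 4 → ℂ :=
  fun i => dirDeriv (V x) (fun y => W y i) x - dirDeriv (W x) (fun y => V y i) x

/-- The value `B(v, w) = Bᵢⱼ vⁱ wʲ` of a covariant 2-tensor. -/
def evalTensor (B : Matrix (Fin 4) (Fin 4) ℂ) (v w : Fin 4 → ℂ) : ℂ :=
  ∑ i, ∑ j, B i j * v i * w j

/-- A metric in coordinates: the real matrix `gᵢⱼ(x)`. -/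
abbrev Metric := Point → Matrix (Fin 4) (Fin 4) ℝ

/-- The (complex bilinear) scalar product `g(v, w)` at `x`. -/
noncomputable def Metric.inner (g : Metric) (x : Point) (v w : Fin 4 → ℂ) : ℂ :=
  evalTensor ((g x).map Complex.ofReal) v w

/-- Lowering an index: `vᵢ = gᵢⱼ vʲ`. -/
noncomputable def Metric.lower (g : Metric) (x : Point) (v : Fin 4 → ℂ) : Fin 4 → ℂ :=
  fun i => ∑ j, (g x i j : ℂ) * v j

/-! ### Null tetrads -/

/-- Two real vector fields `l`, `n` and one complex vector field `m`. -/
structure Tetrad where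
  l : Point → Fin 4 → ℝ
  n : Point → Fin 4 → ℝ
  m : Point → Fin 4 → ℂ

/-- The frame `e₀ = l`, `e₁ = n`, `e₂ = m`, `e₃ = m̄`; as derivations `D`, `Δ`, `δ`, `δ̄`. -/
noncomputable def Tetrad.frame (T : Tetrad) : Fin 4 → Point → Fin 4 → ℂ :=
  ![fun x i => (T.l x i : ℂ), fun x i => (T.n x i : ℂ), T.m,
    fun x i => (starRingEnd ℂ) (T.m x i)]

/-- The scalar products of a null tetrad, `l·n = 1 = -m·m̄`; this matrix is its own inverse. -/
def eta : Matrix (Fin 4) (Fin 4) ℂ :=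
  !![0, 1, 0, 0; 1, 0, 0, 0; 0, 0, 0, -1; 0, 0, -1, 0]

/-- `g` is a smooth metric on `U` and `T` a smooth null tetrad for it. Nondegeneracy of `g`, its
signature `(+,-,-,-)`, and the linear independence of the tetrad follow from the scalar products. -/
structure IsNullTetrad (U : Set Point) (g : Metric) (T : Tetrad) : Prop where
  symm : ∀ x ∈ U, (g x).IsSymm
  smooth_g : ∀ i j, ContDiffOn ℝ ∞ (fun x => g x i j) U
  smooth_l : ContDiffOn ℝ ∞ T.l U
  smooth_n : ContDiffOn ℝ ∞ T.n U
  smooth_m : ContDiffOn ℝ ∞ T.m U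
  inner_frame : ∀ x ∈ U, ∀ a b, g.inner x (T.frame a x) (T.frame b x) = eta a b

/-- The rotation of the tetrad about the direction of `l` with real parameters `a` (boost), `b`
(spin) and complex parameter `p` (null rotation):
`l ↦ eᵃ l`, `m ↦ eⁱᵇ (m - p̄ l)`, `n ↦ e⁻ᵃ (n + p p̄ l - p m - p̄ m̄)`. -/
noncomputable def Tetrad.rotate (T : Tetrad) (a b : Point → ℝ) (p : Point → ℂ) : Tetrad where
  l x i := Real.exp (a x) * T.l x i
  n x i := Real.exp (-a x) *
    (T.n x i + Complex.normSq (p x) * T.l x i - 2 * (p x * T.m x i).re)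
  m x i := Complex.exp (Complex.I * (b x : ℂ)) *
    (T.m x i - (starRingEnd ℂ) (p x) * (T.l x i : ℂ))

/-! ### Levi-Civita connection and curvature in the tetrad -/

section

variable (g : Metric) (T : Tetrad)

/-- `g([eₐ, e_b], e_k)`. -/
noncomputable def struct (a b k : Fin 4) (x : Point) : ℂ :=
  g.inner x (bracket (T.frame a) (T.frame b) x) (T.frame k x)

/-- `g(∇_{eₐ} e_b, e_k)` for the Levi-Civita connection `∇` of `g`, by the Koszul formula (the
scalar products of the frame vectors are constant). -/
noncomputable def conn (a b k : Fin 4) (x : Point) : ℂ :=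
  (1 / 2) * (struct g T a b k x - struct g T b k a x + struct g T k a b x)

/-- The Riemann tensor `R_{abcd} = g(∇_c ∇_d e_a - ∇_d ∇_c e_a - ∇_{[e_c, e_d]} e_a, e_b)`. With
this sign the vacuum curvature scalar of de Sitter space is positive in signature `(+,-,-,-)`. -/
noncomputable def riemann (a b c d : Fin 4) (x : Point) : ℂ :=
  dirDeriv (T.frame c x) (conn g T d a b) x - dirDeriv (T.frame d x) (conn g T c a b) x
    + ∑ f, ∑ h, eta f h * (conn g T d a h x * conn g T c f b x
        - conn g T c a h x * conn g T d f b x - struct g T c d h x * conn g T f a b x)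

/-- The Ricci tensor `R_{bd} = η^{ac} R_{abcd}`. -/
noncomputable def ricci (b d : Fin 4) (x : Point) : ℂ :=
  ∑ a, ∑ c, eta a c * riemann g T a b c d x

/-- The scalar curvature. -/
noncomputable def scalar (x : Point) : ℂ :=
  ∑ b, ∑ d, eta b d * ricci g T b d x

/-- The Weyl tensor `C_{abcd}`. -/
noncomputable def weyl (a b c d : Fin 4) (x : Point) : ℂ :=
  riemann g T a b c d x
    - (1 / 2) * (eta a c * ricci g T b d x - eta a d * ricci g T b c x
        - eta b c * ricci g T a d x + eta b d * ricci g T a c x)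
    + scalar g T x / 6 * (eta a c * eta b d - eta a d * eta b c)

/-- Vacuum with cosmological constant, in terms of the Newman-Penrose curvature scalar
`Λ = R / 24`: the Ricci tensor is `6 Λ g`. -/
def IsVacuum (U : Set Point) (Λ : ℝ) : Prop :=
  ∀ x ∈ U, ∀ a b, ricci g T a b x = 6 * (Λ : ℂ) * eta a b

/-! ### The Newman-Penrose scalars -/

/-- `κ = g(∇_l l, m)`; the congruence of `l` is geodesic if and only if `κ = 0`. -/
noncomputable def kappa (x : Point) : ℂ := conn g T 0 0 2 x
/-- `τ = g(∇_n l, m)`. -/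
noncomputable def tau (x : Point) : ℂ := conn g T 1 0 2 x
/-- `σ = g(∇_m l, m)`, the shear of the congruence of `l`. -/
noncomputable def sigma (x : Point) : ℂ := conn g T 2 0 2 x
/-- `ρ = g(∇_m̄ l, m)`, the complex divergence of the congruence of `l`. -/
noncomputable def rho (x : Point) : ℂ := conn g T 3 0 2 x
/-- `π = -g(∇_l n, m̄)`. -/
noncomputable def pi (x : Point) : ℂ := -conn g T 0 1 3 x
/-- `ν = -g(∇_n n, m̄)`. -/
noncomputable def nu (x : Point) : ℂ := -conn g T 1 1 3 x
/-- `μ = -g(∇_m n, m̄)`. -/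
noncomputable def mu (x : Point) : ℂ := -conn g T 2 1 3 x
/-- `λ = -g(∇_m̄ n, m̄)`. -/
noncomputable def lambda (x : Point) : ℂ := -conn g T 3 1 3 x
/-- `ε = (g(∇_l l, n) - g(∇_l m, m̄)) / 2`. -/
noncomputable def epsilon (x : Point) : ℂ := (1 / 2) * (conn g T 0 0 1 x - conn g T 0 2 3 x)
/-- `γ = (g(∇_n l, n) - g(∇_n m, m̄)) / 2`. -/
noncomputable def gamma (x : Point) : ℂ := (1 / 2) * (conn g T 1 0 1 x - conn g T 1 2 3 x)
/-- `β = (g(∇_m l, n) - g(∇_m m, m̄)) / 2`. -/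
noncomputable def beta (x : Point) : ℂ := (1 / 2) * (conn g T 2 0 1 x - conn g T 2 2 3 x)
/-- `α = (g(∇_m̄ l, n) - g(∇_m̄ m, m̄)) / 2`. -/
noncomputable def alpha (x : Point) : ℂ := (1 / 2) * (conn g T 3 0 1 x - conn g T 3 2 3 x)

/-- `Ψ₀ = C(l, m, l, m)`. -/
noncomputable def psi0 (x : Point) : ℂ := weyl g T 0 2 0 2 x
/-- `Ψ₁ = C(l, n, l, m)`. -/
noncomputable def psi1 (x : Point) : ℂ := weyl g T 0 1 0 2 x
/-- `Ψ₂ = (C(l, n, l, n) - C(l, n, m, m̄)) / 2`. -/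
noncomputable def psi2 (x : Point) : ℂ := (1 / 2) * (weyl g T 0 1 0 1 x - weyl g T 0 1 2 3 x)
/-- `Ψ₃ = C(n, l, n, m̄)`. -/
noncomputable def psi3 (x : Point) : ℂ := weyl g T 1 0 1 3 x
/-- `Ψ₄ = C(n, m̄, n, m̄)`. -/
noncomputable def psi4 (x : Point) : ℂ := weyl g T 1 3 1 3 x

/-! ### Petrov types -/

/-- The binary quartic form whose roots in `ℂP¹` are the principal null directions. -/
noncomputable def weylQuartic (x : Point) (s t : ℂ) : ℂ :=
  psi0 g T x * s ^ 4 + 4 * psi1 g T x * s ^ 3 * t + 6 * psi2 g T x * s ^ 2 * t ^ 2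
    + 4 * psi3 g T x * s * t ^ 3 + psi4 g T x * t ^ 4

/-- Petrov type O (conformally flat): the Weyl tensor vanishes at `x`. -/
def IsPetrovO (x : Point) : Prop :=
  ∀ s t : ℂ, weylQuartic g T x s t = 0

/-- Petrov type N: one quadruple principal null direction. -/
def IsPetrovN (x : Point) : Prop :=
  ∃ a b : ℂ, (a ≠ 0 ∨ b ≠ 0) ∧ ∀ s t : ℂ, weylQuartic g T x s t = (a * s + b * t) ^ 4

/-- Petrov type D: two distinct double principal null directions. -/
def IsPetrovD (x : Point) : Prop :=
  ∃ a b c d : ℂ, a * d - b * c ≠ 0 ∧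
    ∀ s t : ℂ, weylQuartic g T x s t = ((a * s + b * t) * (c * s + d * t)) ^ 2

/-! ### Killing tensors -/

/-- `(∇_{e_c} K)(eₐ, e_b)` for a covariant 2-tensor field `K` given by its coordinate components. -/
noncomputable def covDeriv (K : Point → Matrix (Fin 4) (Fin 4) ℂ) (c a b : Fin 4) (x : Point) : ℂ :=
  dirDeriv (T.frame c x) (fun y => evalTensor (K y) (T.frame a y) (T.frame b y)) x
    - ∑ f, ∑ h, eta f h * (conn g T c a h x * evalTensor (K x) (T.frame f x) (T.frame b x)
        + conn g T c b h x * evalTensor (K x) (T.frame a x) (T.frame f x))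

/-- A Killing tensor: a symmetric 2-tensor with `K_{(ab;c)} = 0`. -/
def IsKillingTensor (U : Set Point) (K : Point → Matrix (Fin 4) (Fin 4) ℂ) : Prop :=
  ∀ x ∈ U, (K x).IsSymm ∧
    ∀ a b c, covDeriv g T K c a b x + covDeriv g T K a b c x + covDeriv g T K b c a x = 0

/-- The reduced form (`λ₀ = 0`), with real functions `k₁ = λ₁`, `k₂ = λ₂`, `k₇ = λ₇`:
`K = λ₁ (n l + l n) + λ₂ (m m̄ + m̄ m) + λ₇ (m m + m̄ m̄)`, all indices down. -/
noncomputable def formK4 (k₁ k₂ k₇ : Point → ℝ) (x : Point) : Matrix (Fin 4) (Fin 4) ℂ :=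
  let e : Fin 4 → Fin 4 → ℂ := fun a => g.lower x (T.frame a x)
  Matrix.of fun i j =>
    (k₁ x : ℂ) * (e 1 i * e 0 j + e 0 i * e 1 j)
      + (k₂ x : ℂ) * (e 2 i * e 3 j + e 3 i * e 2 j)
      + (k₇ x : ℂ) * (e 2 i * e 2 j + e 3 i * e 3 j)

end

/-- A vacuum spacetime with `R = 24 Λ` on the open set `U`, with a Killing tensor of the reduced
form with three distinct eigenvalues `λ₁` (double), `-(λ₂ + λ₇)`, `-(λ₂ - λ₇)`. -/
structure IsK4Solution (U : Set Point) (g : Metric) (T : Tetrad) (Λ : ℝ)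
    (k₁ k₂ k₇ : Point → ℝ) : Prop where
  isOpen : IsOpen U
  tetrad : IsNullTetrad U g T
  vacuum : IsVacuum g T U Λ
  smooth₁ : ContDiffOn ℝ ∞ k₁ U
  smooth₂ : ContDiffOn ℝ ∞ k₂ U
  smooth₇ : ContDiffOn ℝ ∞ k₇ U
  killing : IsKillingTensor g T U (formK4 g T k₁ k₂ k₇)
  eigenvalues_ne : ∀ x ∈ U,
    k₁ x ≠ -(k₂ x + k₇ x) ∧ k₁ x ≠ -(k₂ x - k₇ x) ∧ -(k₂ x + k₇ x) ≠ -(k₂ x - k₇ x)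

/-- The rotation about `l` with parameters `a`, `b`, `p` leaves the Killing tensor invariant, and
it annihilates the spin coefficients `ε`, `γ`, `α`, `β`. -/
structure IsAdaptedRotation (U : Set Point) (g : Metric) (T : Tetrad) (k₁ k₂ k₇ : Point → ℝ)
    (a b : Point → ℝ) (p : Point → ℂ) : Prop where
  smooth_a : ContDiffOn ℝ ∞ a U
  smooth_b : ContDiffOn ℝ ∞ b U
  smooth_p : ContDiffOn ℝ ∞ p U
  invariant : ∀ x ∈ U, formK4 g (T.rotate a b p) k₁ k₂ k₇ x = formK4 g T k₁ k₂ k₇ x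
  epsilon_eq : ∀ x ∈ U, epsilon g (T.rotate a b p) x = 0
  gamma_eq : ∀ x ∈ U, gamma g (T.rotate a b p) x = 0
  alpha_eq : ∀ x ∈ U, alpha g (T.rotate a b p) x = 0
  beta_eq : ∀ x ∈ U, beta g (T.rotate a b p) x = 0

/-- Class I: `ρ ≠ 0 = π`. -/
def IsClassI (U : Set Point) (g : Metric) (T : Tetrad) : Prop :=
  ∀ x ∈ U, rho g T x ≠ 0 ∧ pi g T x = 0

end NewmanPenrose

open NewmanPenrose

namespace NewmanPenrose

/-! ### Rules of calculus for `dirDeriv` -/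

section Calculus

variable {U : Set Point} {x : Point} {φ ψ : Point → ℂ} {v : Fin 4 → ℂ}

theorem dirDeriv_congr (hU : IsOpen U) (hx : x ∈ U) (h : ∀ y ∈ U, φ y = ψ y) :
    dirDeriv v φ x = dirDeriv v ψ x := by
  have : φ =ᶠ[𝓝 x] ψ := Filter.eventually_of_mem (hU.mem_nhds hx) h
  simp only [dirDeriv, this.fderiv_eq]

theorem dirDeriv_const (c : ℂ) : dirDeriv v (fun _ => c) x = 0 := by
  simp [dirDeriv]

theorem dirDeriv_eq_zero (hU : IsOpen U) (hx : x ∈ U) {c : ℂ} (h : ∀ y ∈ U, φ y = c) :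
    dirDeriv v φ x = 0 :=
  (dirDeriv_congr hU hx h).trans (dirDeriv_const c)

theorem dirDeriv_add (hφ : DifferentiableAt ℝ φ x) (hψ : DifferentiableAt ℝ ψ x) :
    dirDeriv v (fun y => φ y + ψ y) x = dirDeriv v φ x + dirDeriv v ψ x := by
  simp only [dirDeriv, fderiv_fun_add hφ hψ, ← Finset.sum_add_distrib]
  exact Finset.sum_congr rfl fun i _ => by simp; ring

theorem dirDeriv_sub (hφ : DifferentiableAt ℝ φ x) (hψ : DifferentiableAt ℝ ψ x) :
    dirDeriv v (fun y => φ y - ψ y) x = dirDeriv v φ x - dirDeriv v ψ x := by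
  simp only [dirDeriv, fderiv_fun_sub hφ hψ, ← Finset.sum_sub_distrib]
  exact Finset.sum_congr rfl fun i _ => by simp; ring

theorem dirDeriv_neg : dirDeriv v (fun y => -φ y) x = -dirDeriv v φ x := by
  simp only [dirDeriv, fderiv_fun_neg, ← Finset.sum_neg_distrib]
  exact Finset.sum_congr rfl fun i _ => by simp

theorem dirDeriv_mul (hφ : DifferentiableAt ℝ φ x) (hψ : DifferentiableAt ℝ ψ x) :
    dirDeriv v (fun y => φ y * ψ y) x = φ x * dirDeriv v ψ x + dirDeriv v φ x * ψ x := by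
  simp only [dirDeriv, fderiv_fun_mul hφ hψ, Finset.mul_sum, Finset.sum_mul,
    ← Finset.sum_add_distrib]
  exact Finset.sum_congr rfl fun i _ => by simp; ring

theorem dirDeriv_const_mul (c : ℂ) (hφ : DifferentiableAt ℝ φ x) :
    dirDeriv v (fun y => c * φ y) x = c * dirDeriv v φ x := by
  rw [dirDeriv_mul (differentiableAt_const c) hφ, dirDeriv_const, zero_mul, add_zero]

theorem dirDeriv_sum {ι : Type*} (s : Finset ι) {F : ι → Point → ℂ}
    (h : ∀ i ∈ s, DifferentiableAt ℝ (F i) x) :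
    dirDeriv v (fun y => ∑ i ∈ s, F i y) x = ∑ i ∈ s, dirDeriv v (F i) x := by
  simp only [dirDeriv, fderiv_fun_sum h, FunLike.coe_sum, Finset.sum_apply,
    Finset.mul_sum]
  exact Finset.sum_comm

theorem dirDeriv_exp (hφ : DifferentiableAt ℝ φ x) :
    dirDeriv v (fun y => Complex.exp (φ y)) x = Complex.exp (φ x) * dirDeriv v φ x := by
  simp only [dirDeriv, hφ.hasFDerivAt.cexp.fderiv, Finset.mul_sum]
  exact Finset.sum_congr rfl fun i _ => by simp; ring

theorem dirDeriv_conj :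
    (starRingEnd ℂ) (dirDeriv v φ x)
      = dirDeriv (fun i => (starRingEnd ℂ) (v i)) (fun y => (starRingEnd ℂ) (φ y)) x := by
  have h : fderiv ℝ (fun y => (starRingEnd ℂ) (φ y)) x
      = (Complex.conjCLE : ℂ →L[ℝ] ℂ).comp (fderiv ℝ φ x) :=
    Complex.conjCLE.comp_fderiv (f := φ) (x := x)
  simp only [dirDeriv, h, map_sum, map_mul]
  rfl

theorem dirDeriv_linear {ι : Type*} (s : Finset ι) (c : ι → ℂ) (w : ι → Fin 4 → ℂ) :
    dirDeriv (fun i => ∑ k ∈ s, c k * w k i) φ x = ∑ k ∈ s, c k * dirDeriv (w k) φ x := by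
  simp only [dirDeriv, Finset.sum_mul, Finset.mul_sum]
  rw [Finset.sum_comm]
  exact Finset.sum_congr rfl fun i _ => Finset.sum_congr rfl fun j _ => by ring

theorem contDiffOn_dirDeriv (hU : IsOpen U) {V : Point → Fin 4 → ℂ}
    (hV : ∀ i, ContDiffOn ℝ ∞ (fun y => V y i) U) (hφ : ContDiffOn ℝ ∞ φ U) :
    ContDiffOn ℝ ∞ (fun y => dirDeriv (V y) φ y) U := by
  unfold dirDeriv
  refine ContDiffOn.sum fun i _ => (hV i).mul ?_
  exact (hφ.fderiv_of_isOpen hU (by simp)).clm_apply contDiffOn_const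

theorem ContDiffOn.differentiableAt_of_isOpen (hφ : ContDiffOn ℝ ∞ φ U) (hU : IsOpen U)
    (hx : x ∈ U) : DifferentiableAt ℝ φ x :=
  (hφ.contDiffAt (hU.mem_nhds hx)).differentiableAt (by simp)

theorem dirDeriv_commutator (hU : IsOpen U) (hx : x ∈ U) {V W : Point → Fin 4 → ℂ}
    (hV : ∀ i, ContDiffOn ℝ ∞ (fun y => V y i) U) (hW : ∀ i, ContDiffOn ℝ ∞ (fun y => W y i) U)
    (hφ : ContDiffOn ℝ ∞ φ U) :
    dirDeriv (V x) (fun y => dirDeriv (W y) φ y) x - dirDeriv (W x) (fun y => dirDeriv (V y) φ y) x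
      = dirDeriv (bracket V W x) φ x := by
  have hc : ContDiffAt ℝ 2 φ x :=
    contDiffAt_infty.1 (hφ.contDiffAt (hU.mem_nhds hx)) 2
  have hd : DifferentiableAt ℝ (fderiv ℝ φ) x :=
    (hc.fderiv_right (m := 1) (by norm_num)).differentiableAt one_ne_zero
  have hsymm : ∀ u w, fderiv ℝ (fderiv ℝ φ) x u w = fderiv ℝ (fderiv ℝ φ) x w u :=
    fun u w => hc.isSymmSndFDerivAt (by simp) u w
  have key : ∀ (v : Fin 4 → ℂ) (W : Point → Fin 4 → ℂ),
      (∀ i, ContDiffOn ℝ ∞ (fun y => W y i) U) →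
      dirDeriv v (fun y => dirDeriv (W y) φ y) x
        = dirDeriv (fun i => dirDeriv v (fun y => W y i) x) φ x
          + ∑ i, ∑ j, v j * W x i *
            fderiv ℝ (fderiv ℝ φ) x (Pi.single j 1) (Pi.single i 1) := by
    intro v W hW
    have hp : ∀ i : Fin 4, DifferentiableAt ℝ (fun y => fderiv ℝ φ y (Pi.single i 1)) x :=
      fun i => hd.clm_apply (differentiableAt_const _)
    have hw : ∀ i : Fin 4, DifferentiableAt ℝ (fun y => W y i) x :=
      fun i => (hW i).differentiableAt_of_isOpen hU hx
    have e : (fun y => dirDeriv (W y) φ y)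
        = fun y => ∑ i, W y i * fderiv ℝ φ y (Pi.single i 1) := rfl
    rw [e, dirDeriv_sum _ fun i _ => (hw i).fun_mul (hp i)]
    simp only [dirDeriv_mul (hw _) (hp _), Finset.sum_add_distrib]
    rw [add_comm]
    congr 1
    refine Finset.sum_congr rfl fun i _ => ?_
    simp only [dirDeriv, Finset.mul_sum]
    refine Finset.sum_congr rfl fun j _ => ?_
    rw [fderiv_clm_apply hd (differentiableAt_const _)]
    simp
    ring
  rw [key _ W hW, key _ V hV]
  have e : dirDeriv (bracket V W x) φ x
      = dirDeriv (fun i => dirDeriv (V x) (fun y => W y i) x) φ x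
        - dirDeriv (fun i => dirDeriv (W x) (fun y => V y i) x) φ x := by
    simp only [dirDeriv, bracket, sub_mul, Finset.sum_sub_distrib]
  rw [e, Finset.sum_comm (f := fun i j => V x j * W x i * _)]
  have : ∀ i j : Fin 4, V x i * W x j *
      fderiv ℝ (fderiv ℝ φ) x (Pi.single i 1) (Pi.single j 1)
      = W x j * V x i * fderiv ℝ (fderiv ℝ φ) x (Pi.single j 1) (Pi.single i 1) :=
    fun i j => by rw [hsymm]; ring
  simp only [this]
  ring

end Calculus

/-! ### Identities of the connection and curvature in a null tetrad -/

section Algebra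

variable {g : Metric} {T : Tetrad} {x : Point}

theorem struct_antisymm (a b k : Fin 4) : struct g T a b k x = -struct g T b a k x := by
  simp only [struct, Metric.inner, evalTensor, ← Finset.sum_neg_distrib, bracket]
  exact Finset.sum_congr rfl fun i _ => Finset.sum_congr rfl fun j _ => by ring

theorem conn_antisymm (a b k : Fin 4) : conn g T a b k x = -conn g T a k b x := by
  have h := fun a b k => struct_antisymm (g := g) (T := T) (x := x) a b k
  simp only [conn]
  linear_combination (1 / 2) * h a b k - (1 / 2) * h b k a + (1 / 2) * h k a b

theorem conn_torsionFree (a b k : Fin 4) :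
    struct g T a b k x = conn g T a b k x - conn g T b a k x := by
  have h := fun a b k => struct_antisymm (g := g) (T := T) (x := x) a b k
  simp only [conn]
  linear_combination (1 / 2) * h a b k + (1 / 2) * h k b a - (1 / 2) * h k a b

theorem conn_self (a b : Fin 4) : conn g T a b b x = 0 := by
  linear_combination (1 / 2) * conn_antisymm (g := g) (T := T) (x := x) a b b

theorem eta_sum (F : Fin 4 → Fin 4 → ℂ) :
    ∑ f, ∑ h, eta f h * F f h = F 0 1 + F 1 0 - F 2 3 - F 3 2 := by
  simp [Fin.sum_univ_four, eta]
  ring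

theorem riemann_eq (a b c d : Fin 4) : riemann g T a b c d x
    = dirDeriv (T.frame c x) (conn g T d a b) x - dirDeriv (T.frame d x) (conn g T c a b) x
      + ∑ f, ∑ h, eta f h * (conn g T d a h x * conn g T c f b x
        - conn g T c a h x * conn g T d f b x - struct g T c d h x * conn g T f a b x) := rfl

theorem riemann_antisymm_right (a b c d : Fin 4) :
    riemann g T a b c d x = -riemann g T a b d c x := by
  simp only [riemann_eq, eta_sum, struct_antisymm c d]
  ring

theorem riemann_antisymm_left (a b c d : Fin 4) :
    riemann g T a b c d x = -riemann g T b a c d x := by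
  have h : ∀ c, conn g T c a b = fun y => -conn g T c b a y :=
    fun c => funext fun y => conn_antisymm c a b
  simp only [riemann_eq, eta_sum, h, dirDeriv_neg]
  simp only [conn_antisymm _ 0 b, conn_antisymm _ 1 b, conn_antisymm _ 2 b, conn_antisymm _ 3 b,
    conn_antisymm _ 0 a, conn_antisymm _ 1 a, conn_antisymm _ 2 a, conn_antisymm _ 3 a]
  ring

end Algebra

section Frame

variable {U : Set Point} {g : Metric} {T : Tetrad} {x : Point}

theorem IsNullTetrad.contDiffOn_frame (h : IsNullTetrad U g T) (a i : Fin 4) :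
    ContDiffOn ℝ ∞ (fun y => T.frame a y i) U := by
  have hl := fun i => (contDiffOn_pi.1 h.smooth_l i)
  have hn := fun i => (contDiffOn_pi.1 h.smooth_n i)
  have hm := fun i => (contDiffOn_pi.1 h.smooth_m i)
  have hr : ContDiff ℝ ∞ (fun r : ℝ => (r : ℂ)) := Complex.ofRealCLM.contDiff
  have hc : ContDiff ℝ ∞ (fun z : ℂ => (starRingEnd ℂ) z) := Complex.conjCLE.contDiff
  fin_cases a
  · exact hr.comp_contDiffOn (hl i)
  · exact hr.comp_contDiffOn (hn i)
  · exact hm i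
  · exact hc.comp_contDiffOn (hm i)

theorem IsNullTetrad.contDiffOn_bracket (h : IsNullTetrad U g T) (hU : IsOpen U) (a b i : Fin 4) :
    ContDiffOn ℝ ∞ (fun y => bracket (T.frame a) (T.frame b) y i) U :=
  (contDiffOn_dirDeriv hU (h.contDiffOn_frame a) (h.contDiffOn_frame b i)).sub
    (contDiffOn_dirDeriv hU (h.contDiffOn_frame b) (h.contDiffOn_frame a i))

theorem IsNullTetrad.contDiffOn_struct (h : IsNullTetrad U g T) (hU : IsOpen U) (a b k : Fin 4) :
    ContDiffOn ℝ ∞ (struct g T a b k) U := by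
  have hr : ContDiff ℝ ∞ (fun r : ℝ => (r : ℂ)) := Complex.ofRealCLM.contDiff
  have e : struct g T a b k = fun y => ∑ i, ∑ j,
      (g y i j : ℂ) * bracket (T.frame a) (T.frame b) y i * T.frame k y j := rfl
  rw [e]
  refine ContDiffOn.sum fun i _ => ContDiffOn.sum fun j _ => ?_
  exact ((hr.comp_contDiffOn (h.smooth_g i j)).mul (h.contDiffOn_bracket hU a b i)).mul
    (h.contDiffOn_frame k j)

theorem IsNullTetrad.contDiffOn_conn (h : IsNullTetrad U g T) (hU : IsOpen U) (a b k : Fin 4) :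
    ContDiffOn ℝ ∞ (conn g T a b k) U :=
  contDiffOn_const.mul (((h.contDiffOn_struct hU a b k).sub (h.contDiffOn_struct hU b k a)).add
    (h.contDiffOn_struct hU k a b))

theorem IsNullTetrad.differentiableAt_conn (h : IsNullTetrad U g T) (hU : IsOpen U) (hx : x ∈ U)
    (a b k : Fin 4) : DifferentiableAt ℝ (conn g T a b k) x :=
  (h.contDiffOn_conn hU a b k).differentiableAt_of_isOpen hU hx

theorem IsNullTetrad.contDiffOn_riemann (h : IsNullTetrad U g T) (hU : IsOpen U)
    (a b c d : Fin 4) : ContDiffOn ℝ ∞ (riemann g T a b c d) U := by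
  refine ((contDiffOn_dirDeriv hU (h.contDiffOn_frame c) (h.contDiffOn_conn hU d a b)).sub
    (contDiffOn_dirDeriv hU (h.contDiffOn_frame d) (h.contDiffOn_conn hU c a b))).add ?_
  refine ContDiffOn.sum fun f _ => ContDiffOn.sum fun k _ => contDiffOn_const.mul ?_
  exact (((h.contDiffOn_conn hU d a k).mul (h.contDiffOn_conn hU c f b)).sub
    ((h.contDiffOn_conn hU c a k).mul (h.contDiffOn_conn hU d f b))).sub
    ((h.contDiffOn_struct hU c d k).mul (h.contDiffOn_conn hU f a b))

/-- A vector is determined by its scalar products with the frame. -/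
theorem IsNullTetrad.expand (h : IsNullTetrad U g T) (hx : x ∈ U) (w : Fin 4 → ℂ) (i : Fin 4) :
    w i = ∑ f, (∑ k, eta f k * g.inner x w (T.frame k x)) * T.frame f x i := by
  set E : Matrix (Fin 4) (Fin 4) ℂ := Matrix.of fun a i => T.frame a x i with hE
  set G : Matrix (Fin 4) (Fin 4) ℂ := (g x).map Complex.ofReal with hG
  have h1 : E * G * E.transpose = eta := by
    ext a b
    rw [← h.inner_frame x hx a b]
    simp only [Matrix.mul_apply, Metric.inner, evalTensor, Matrix.transpose_apply, Finset.sum_mul,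
      hE, Matrix.of_apply]
    rw [Finset.sum_comm]
    exact Finset.sum_congr rfl fun i _ => Finset.sum_congr rfl fun j _ => by ring
  have h2 : eta * eta = 1 := by
    ext i j
    fin_cases i <;> fin_cases j <;> simp [eta, Matrix.mul_apply, Fin.sum_univ_four]
  have h3 : E * (G * E.transpose * eta) = 1 := by
    rw [← Matrix.mul_assoc, ← Matrix.mul_assoc, h1, h2]
  have h4 : (G * E.transpose * eta) * E = 1 := mul_eq_one_comm.1 h3
  have h5 : Matrix.vecMul w ((G * E.transpose * eta) * E) i = w i := by rw [h4, Matrix.vecMul_one]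
  have hs : ∀ f k, eta f k = eta k f := by
    intro f k
    fin_cases f <;> fin_cases k <;> simp [eta]
  rw [← h5, ← Matrix.vecMul_vecMul, ← Matrix.vecMul_vecMul, ← Matrix.vecMul_vecMul]
  simp only [Matrix.vecMul, dotProduct, Metric.inner, evalTensor, hE, Matrix.transpose_apply,
    Matrix.of_apply]
  refine Finset.sum_congr rfl fun f _ => ?_
  congr 1
  refine Finset.sum_congr rfl fun k _ => ?_
  rw [hs f k, mul_comm]
  congr 1
  simp only [Finset.sum_mul]
  rw [Finset.sum_comm]
  exact Finset.sum_congr rfl fun i _ => Finset.sum_congr rfl fun j _ => by ring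

/-- The commutator of frame derivatives. -/
theorem IsNullTetrad.commutator (h : IsNullTetrad U g T) (hU : IsOpen U) (hx : x ∈ U)
    {φ : Point → ℂ} (hφ : ContDiffOn ℝ ∞ φ U) (c d : Fin 4) :
    dirDeriv (T.frame c x) (fun y => dirDeriv (T.frame d y) φ y) x
        - dirDeriv (T.frame d x) (fun y => dirDeriv (T.frame c y) φ y) x
      = ∑ f, (∑ k, eta f k * struct g T c d k x) * dirDeriv (T.frame f x) φ x := by
  rw [dirDeriv_commutator hU hx (h.contDiffOn_frame c) (h.contDiffOn_frame d) hφ,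
    ← dirDeriv_linear]
  congr 1
  exact funext fun i => h.expand hx _ i

theorem eta_sum_mul (F G : Fin 4 → ℂ) :
    ∑ f, (∑ k, eta f k * F k) * G f = F 1 * G 0 + F 0 * G 1 - F 3 * G 2 - F 2 * G 3 := by
  simp [Fin.sum_univ_four, eta]
  ring

theorem IsNullTetrad.inner_expand (h : IsNullTetrad U g T) (hx : x ∈ U) {J : Fin 4 → ℂ}
    (hJ : ∀ i, ∑ f, J f * T.frame f x i = 0) : J = 0 := by
  have key : ∀ k, ∑ f, J f * eta f k = 0 := by
    intro k
    calc ∑ f, J f * eta f k = ∑ f, J f * g.inner x (T.frame f x) (T.frame k x) :=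
          Finset.sum_congr rfl fun f _ => by rw [h.inner_frame x hx]
      _ = ∑ i, ∑ j, (g x i j : ℂ) * (∑ f, J f * T.frame f x i) * T.frame k x j := by
          simp only [Metric.inner, evalTensor, Finset.mul_sum, Finset.sum_mul]
          rw [Finset.sum_comm]
          refine Finset.sum_congr rfl fun i _ => ?_
          rw [Finset.sum_comm]
          refine Finset.sum_congr rfl fun j _ => Finset.sum_congr rfl fun f _ => ?_
          simp only [Matrix.map_apply]
          ring
      _ = 0 := by simp [hJ]
  ext f
  have k0 := key 0
  have k1 := key 1
  have k2 := key 2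
  have k3 := key 3
  simp [Fin.sum_univ_four, eta] at k0 k1 k2 k3
  fin_cases f <;> simp [k0, k1, k2, k3]

/-- The Jacobi identity for the structure functions. -/
theorem IsNullTetrad.jacobi (h : IsNullTetrad U g T) (hU : IsOpen U) (hx : x ∈ U)
    (a b c k : Fin 4) :
    (dirDeriv (T.frame a x) (struct g T b c k) x
        + ∑ f, ∑ e, eta f e * (struct g T b c e x * struct g T a f k x))
      + (dirDeriv (T.frame b x) (struct g T c a k) x
        + ∑ f, ∑ e, eta f e * (struct g T c a e x * struct g T b f k x))
      + (dirDeriv (T.frame c x) (struct g T a b k) x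
        + ∑ f, ∑ e, eta f e * (struct g T a b e x * struct g T c f k x)) = 0 := by
  set s : Fin 4 → Fin 4 → Fin 4 → Point → ℂ := fun a b f y => ∑ k, eta f k * struct g T a b k y
    with hs
  have hsd : ∀ a b f, DifferentiableAt ℝ (s a b f) x := fun a b f =>
    DifferentiableAt.fun_sum fun k _ => (differentiableAt_const _).fun_mul
      ((h.contDiffOn_struct hU a b k).differentiableAt_of_isOpen hU hx)
  have hsub : ∀ (a b c : Fin 4) (φ : Point → ℂ), ContDiffOn ℝ ∞ φ U →
      dirDeriv (T.frame a x) (fun y => dirDeriv (T.frame b y)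
          (fun z => dirDeriv (T.frame c z) φ z) y) x
        - dirDeriv (T.frame a x) (fun y => dirDeriv (T.frame c y)
          (fun z => dirDeriv (T.frame b z) φ z) y) x
      = ∑ f, (dirDeriv (T.frame a x) (s b c f) x * dirDeriv (T.frame f x) φ x
          + s b c f x * dirDeriv (T.frame a x) (fun y => dirDeriv (T.frame f y) φ y) x) := by
    intro a b c φ hφ
    have hE : ∀ e, ContDiffOn ℝ ∞ (fun y => dirDeriv (T.frame e y) φ y) U :=
      fun e => contDiffOn_dirDeriv hU (h.contDiffOn_frame e) hφ
    have hEE : ∀ e e', DifferentiableAt ℝ (fun y => dirDeriv (T.frame e y)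
        (fun z => dirDeriv (T.frame e' z) φ z) y) x := fun e e' =>
      (contDiffOn_dirDeriv hU (h.contDiffOn_frame e) (hE e')).differentiableAt_of_isOpen hU hx
    rw [← dirDeriv_sub (hEE b c) (hEE c b),
      dirDeriv_congr hU hx fun y hy => h.commutator hU hy hφ b c]
    have hd : ∀ f, DifferentiableAt ℝ (fun y => dirDeriv (T.frame f y) φ y) x :=
      fun f => (hE f).differentiableAt_of_isOpen hU hx
    rw [dirDeriv_sum _ fun f _ => (hsd b c f).fun_mul (hd f)]
    refine Finset.sum_congr rfl fun f _ => ?_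
    rw [dirDeriv_mul (hsd b c f) (hd f)]
    ring
  have hout : ∀ (a b c : Fin 4) (φ : Point → ℂ), ContDiffOn ℝ ∞ φ U →
      dirDeriv (T.frame a x) (fun y => dirDeriv (T.frame b y)
          (fun z => dirDeriv (T.frame c z) φ z) y) x
        - dirDeriv (T.frame b x) (fun y => dirDeriv (T.frame a y)
          (fun z => dirDeriv (T.frame c z) φ z) y) x
      = ∑ f, s a b f x * dirDeriv (T.frame f x) (fun y => dirDeriv (T.frame c y) φ y) x :=
    fun a b c φ hφ => h.commutator hU hx (contDiffOn_dirDeriv hU (h.contDiffOn_frame c) hφ) a b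
  have hcomm : ∀ (a f : Fin 4) (φ : Point → ℂ), ContDiffOn ℝ ∞ φ U →
      dirDeriv (T.frame a x) (fun y => dirDeriv (T.frame f y) φ y) x
        = dirDeriv (T.frame f x) (fun y => dirDeriv (T.frame a y) φ y) x
          + ∑ e, s a f e x * dirDeriv (T.frame e x) φ x :=
    fun a f φ hφ => by linear_combination h.commutator hU hx hφ a f
  set J : Fin 4 → ℂ := fun e =>
    (dirDeriv (T.frame a x) (s b c e) x + ∑ f, s b c f x * s a f e x)
      + (dirDeriv (T.frame b x) (s c a e) x + ∑ f, s c a f x * s b f e x)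
      + (dirDeriv (T.frame c x) (s a b e) x + ∑ f, s a b f x * s c f e x) with hJdef
  have hJφ : ∀ φ : Point → ℂ, ContDiffOn ℝ ∞ φ U → ∑ e, J e * dirDeriv (T.frame e x) φ x = 0 := by
    intro φ hφ
    have e1 := hsub a b c φ hφ
    have e2 := hsub b c a φ hφ
    have e3 := hsub c a b φ hφ
    have o1 := hout a b c φ hφ
    have o2 := hout b c a φ hφ
    have o3 := hout c a b φ hφ
    have q1 := fun f => hcomm a f φ hφ
    have q2 := fun f => hcomm b f φ hφ
    have q3 := fun f => hcomm c f φ hφ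
    simp only [q1] at e1
    simp only [q2] at e2
    simp only [q3] at e3
    simp only [Fin.sum_univ_four] at e1 e2 e3 o1 o2 o3
    simp only [hJdef, Fin.sum_univ_four]
    linear_combination -e1 - e2 - e3 + o1 + o2 + o3
  have hJ : J = 0 := by
    refine h.inner_expand hx fun i => ?_
    have hφ : ContDiff ℝ ∞ (fun y : Point => ((y i : ℝ) : ℂ)) :=
      Complex.ofRealCLM.contDiff.comp (contDiff_apply ℝ ℝ i)
    have hv : ∀ v : Fin 4 → ℂ, dirDeriv v (fun y : Point => ((y i : ℝ) : ℂ)) x = v i := by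
      intro v
      have hf : fderiv ℝ (fun y : Point => ((y i : ℝ) : ℂ)) x
          = Complex.ofRealCLM.comp (ContinuousLinearMap.proj (R := ℝ) i) :=
        (Complex.ofRealCLM.comp (ContinuousLinearMap.proj (R := ℝ)
          (φ := fun _ : Fin 4 => ℝ) i)).hasFDerivAt.fderiv
      simp [dirDeriv, hf, Pi.single_apply, apply_ite Complex.ofReal]
    simpa only [hv] using hJφ _ hφ.contDiffOn
  have hds : ∀ a b c e, dirDeriv (T.frame a x) (s b c e) x
      = ∑ k, eta e k * dirDeriv (T.frame a x) (struct g T b c k) x := by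
    intro a b c e
    have hk : ∀ k, DifferentiableAt ℝ (struct g T b c k) x :=
      fun k => (h.contDiffOn_struct hU b c k).differentiableAt_of_isOpen hU hx
    rw [hs, dirDeriv_sum _ fun k _ => (differentiableAt_const _).fun_mul (hk k)]
    exact Finset.sum_congr rfl fun k _ => dirDeriv_const_mul _ (hk k)
  have j0 := congrFun hJ 0
  have j1 := congrFun hJ 1
  have j2 := congrFun hJ 2
  have j3 := congrFun hJ 3
  simp only [hJdef, hds, Pi.zero_apply] at j0 j1 j2 j3
  simp only [hs, Fin.sum_univ_four, eta] at j0 j1 j2 j3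
  simp at j0 j1 j2 j3
  simp only [eta_sum]
  fin_cases k
  · simp; linear_combination j1
  · simp; linear_combination j0
  · simp; linear_combination -j3
  · simp; linear_combination -j2

/-- The first Bianchi identity. -/
theorem IsNullTetrad.bianchi (h : IsNullTetrad U g T) (hU : IsOpen U) (hx : x ∈ U)
    (a b c d : Fin 4) :
    riemann g T a b c d x + riemann g T c b d a x + riemann g T d b a c x = 0 := by
  have hj := h.jacobi hU hx a c d b
  have hd : ∀ e c d, dirDeriv (T.frame e x) (struct g T c d b) x
      = dirDeriv (T.frame e x) (conn g T c d b) x - dirDeriv (T.frame e x) (conn g T d c b) x := by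
    intro e c d
    rw [← dirDeriv_sub (h.differentiableAt_conn hU hx _ _ _) (h.differentiableAt_conn hU hx _ _ _)]
    exact dirDeriv_congr hU hx fun y _ => conn_torsionFree c d b
  simp only [hd, eta_sum] at hj
  simp only [riemann_eq, eta_sum]
  simp only [conn_torsionFree] at hj ⊢
  linear_combination hj

theorem IsNullTetrad.riemann_pair_symm (h : IsNullTetrad U g T) (hU : IsOpen U) (hx : x ∈ U)
    (a b c d : Fin 4) : riemann g T a b c d x = riemann g T c d a b x := by
  have b1 := h.bianchi hU hx a b c d
  have b2 := h.bianchi hU hx b c d a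
  have b3 := h.bianchi hU hx c d a b
  have b4 := h.bianchi hU hx d a b c
  have r := fun a b c d => riemann_antisymm_right (g := g) (T := T) (x := x) a b c d
  have l := fun a b c d => riemann_antisymm_left (g := g) (T := T) (x := x) a b c d
  grind

end Frame

/-! ### Complex conjugation -/

section Conj

variable {g : Metric} {T : Tetrad} {x : Point}

/-- The permutation of frame indices induced by complex conjugation. -/
def conjIndex : Fin 4 → Fin 4 := ![0, 1, 3, 2]

theorem conj_frame (a : Fin 4) (y : Point) (i : Fin 4) :
    (starRingEnd ℂ) (T.frame a y i) = T.frame (conjIndex a) y i := by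
  fin_cases a <;> simp [Tetrad.frame, conjIndex]

theorem conj_dirDeriv_frame (a : Fin 4) (φ : Point → ℂ) :
    (starRingEnd ℂ) (dirDeriv (T.frame a x) φ x)
      = dirDeriv (T.frame (conjIndex a) x) (fun y => (starRingEnd ℂ) (φ y)) x := by
  rw [dirDeriv_conj]
  simp only [conj_frame]

theorem conj_struct (a b k : Fin 4) : (starRingEnd ℂ) (struct g T a b k x)
    = struct g T (conjIndex a) (conjIndex b) (conjIndex k) x := by
  simp only [struct, Metric.inner, evalTensor, map_sum, map_mul, conj_frame, bracket, map_sub,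
    conj_dirDeriv_frame, Matrix.map_apply, Complex.conj_ofReal]

theorem conj_conn (a b k : Fin 4) : (starRingEnd ℂ) (conn g T a b k x)
    = conn g T (conjIndex a) (conjIndex b) (conjIndex k) x := by
  simp only [conn, map_mul, map_add, map_sub, map_div₀, map_one, map_ofNat, conj_struct]

end Conj

/-! ### Frame components of the Killing tensor -/

section Components

variable {U : Set Point} {g : Metric} {T : Tetrad} {x : Point} {k₁ k₂ k₇ : Point → ℝ}

theorem inner_linear {ι : Type*} (s : Finset ι) (v : Fin 4 → ℂ) (c : ι → ℂ) (w : ι → Fin 4 → ℂ) :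
    g.inner x v (fun i => ∑ k ∈ s, c k * w k i) = ∑ k ∈ s, c k * g.inner x v (w k) := by
  simp only [Metric.inner, evalTensor, Finset.mul_sum]
  rw [Finset.sum_comm' (t' := Finset.univ) (s' := fun _ => s) (by simp)]
  refine Finset.sum_congr rfl fun i _ => ?_
  rw [Finset.sum_comm]
  exact Finset.sum_congr rfl fun j _ => Finset.sum_congr rfl fun k _ => by ring

theorem evalTensor_formK4 (v w : Fin 4 → ℂ) :
    evalTensor (formK4 g T k₁ k₂ k₇ x) v w
      = k₁ x * (g.inner x v (T.frame 1 x) * g.inner x w (T.frame 0 x)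
          + g.inner x v (T.frame 0 x) * g.inner x w (T.frame 1 x))
        + k₂ x * (g.inner x v (T.frame 2 x) * g.inner x w (T.frame 3 x)
          + g.inner x v (T.frame 3 x) * g.inner x w (T.frame 2 x))
        + k₇ x * (g.inner x v (T.frame 2 x) * g.inner x w (T.frame 2 x)
          + g.inner x v (T.frame 3 x) * g.inner x w (T.frame 3 x)) := by
  have hl : ∀ v e : Fin 4 → ℂ, g.inner x v e = ∑ i, g.lower x e i * v i := by
    intro v e
    simp only [Metric.inner, evalTensor, Metric.lower, Finset.sum_mul, Matrix.map_apply]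
    exact Finset.sum_congr rfl fun i _ => Finset.sum_congr rfl fun j _ => by ring
  simp only [hl, evalTensor, formK4, Matrix.of_apply, Fin.sum_univ_four]
  ring

/-- The frame components of the reduced Killing tensor. -/
def frameK4 (k₁ k₂ k₇ : ℂ) : Matrix (Fin 4) (Fin 4) ℂ :=
  !![0, k₁, 0, 0; k₁, 0, 0, 0; 0, 0, k₇, k₂; 0, 0, k₂, k₇]

theorem IsNullTetrad.formK4_frame (h : IsNullTetrad U g T) (hx : x ∈ U) (a b : Fin 4) :
    evalTensor (formK4 g T k₁ k₂ k₇ x) (T.frame a x) (T.frame b x)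
      = frameK4 (k₁ x) (k₂ x) (k₇ x) a b := by
  simp only [evalTensor_formK4, h.inner_frame x hx]
  fin_cases a <;> fin_cases b <;> simp [eta, frameK4]

theorem IsNullTetrad.covDeriv_formK4 (h : IsNullTetrad U g T) (hU : IsOpen U) (hx : x ∈ U)
    (c a b : Fin 4) :
    covDeriv g T (formK4 g T k₁ k₂ k₇) c a b x
      = dirDeriv (T.frame c x) (fun y => frameK4 (k₁ y) (k₂ y) (k₇ y) a b) x
        - ∑ f, ∑ e, eta f e * (conn g T c a e x * frameK4 (k₁ x) (k₂ x) (k₇ x) f b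
          + conn g T c b e x * frameK4 (k₁ x) (k₂ x) (k₇ x) a f) := by
  simp only [covDeriv, h.formK4_frame hx]
  rw [dirDeriv_congr hU hx fun y hy => h.formK4_frame hy a b]

theorem eq_zero_of_conj_relation {c k : ℝ} {z : ℂ} (h1 : c + k ≠ 0) (h2 : c - k ≠ 0)
    (h : (c : ℂ) * z + k * (starRingEnd ℂ) z = 0) : z = 0 := by
  have hre := congrArg Complex.re h
  have him := congrArg Complex.im h
  simp at hre him
  apply Complex.ext
  · have : (c + k) * z.re = 0 := by linear_combination hre
    simpa [h1] using this
  · have : (c - k) * z.im = 0 := by linear_combination him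
    simpa [h2] using this

theorem IsK4Solution.conn_eq_zero {Λ : ℝ} (h : IsK4Solution U g T Λ k₁ k₂ k₇) (hx : x ∈ U) :
    conn g T 0 0 2 x = 0 ∧ conn g T 1 1 3 x = 0 := by
  obtain ⟨e1, e2, e3⟩ := h.eigenvalues_ne x hx
  have hp : (k₁ x + k₂ x) + k₇ x ≠ 0 := fun h => e1 (by linarith)
  have hm : (k₁ x + k₂ x) - k₇ x ≠ 0 := fun h => e2 (by linarith)
  have hc := (h.killing x hx).2
  have cj := fun a b k => conj_conn (g := g) (T := T) (x := x) a b k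
  have as := fun a b k => conn_antisymm (g := g) (T := T) (x := x) a b k
  have cs := fun a b => conn_self (g := g) (T := T) (x := x) a b
  constructor
  · have := hc 0 2 0
    simp only [h.tetrad.covDeriv_formK4 h.isOpen hx, eta_sum] at this
    simp [frameK4, dirDeriv_const, as 0 2 0, cs] at this
    refine eq_zero_of_conj_relation hp hm ?_
    rw [cj]
    simp [conjIndex]
    linear_combination this
  · have := hc 1 3 1
    simp only [h.tetrad.covDeriv_formK4 h.isOpen hx, eta_sum] at this
    simp [frameK4, dirDeriv_const, as 1 3 1, cs] at this
    refine eq_zero_of_conj_relation hp hm ?_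
    rw [cj]
    simp [conjIndex]
    linear_combination this

end Components

/-! ### Rotations of the tetrad -/

section Rotation

variable {U : Set Point} {g : Metric} {T : Tetrad} {x : Point} {k₁ k₂ k₇ : Point → ℝ}
  {a b : Point → ℝ} {p : Point → ℂ}

theorem rotate_trivial (h : IsNullTetrad U g T) (hx : x ∈ U) (h7 : k₇ x ≠ 0)
    (hp : (k₁ x + k₂ x) + k₇ x ≠ 0) (hm : (k₁ x + k₂ x) - k₇ x ≠ 0)
    (hK : formK4 g (T.rotate a b p) k₁ k₂ k₇ x = formK4 g T k₁ k₂ k₇ x) :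
    p x = 0 ∧ Real.sin (b x) = 0 := by
  set s : ℂ := Complex.exp (Complex.I * (b x : ℂ)) with hs
  have hss : s * (starRingEnd ℂ) s = 1 := by
    rw [hs, ← Complex.exp_conj, ← Complex.exp_add]
    simp
  have hee : (Real.exp (a x) : ℂ) * (Real.exp (-a x) : ℂ) = 1 := by
    rw [← Complex.ofReal_mul, ← Real.exp_add]
    simp
  set E : ℂ := (Real.exp (a x) : ℂ)
  set E' : ℂ := (Real.exp (-a x) : ℂ)
  have f0 : (T.rotate a b p).frame 0 x
      = fun i => ∑ k, (![E, 0, 0, 0] : Fin 4 → ℂ) k * T.frame k x i := by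
    ext i
    simp [Tetrad.frame, Tetrad.rotate, Fin.sum_univ_four, E]
  have f1 : (T.rotate a b p).frame 1 x
      = fun i => ∑ k, (![E' * (p x * (starRingEnd ℂ) (p x)), E', -(E' * p x),
          -(E' * (starRingEnd ℂ) (p x))] : Fin 4 → ℂ) k * T.frame k x i := by
    ext i
    have : ((2 * (p x * T.m x i).re : ℝ) : ℂ)
        = p x * T.m x i + (starRingEnd ℂ) (p x * T.m x i) := by
      rw [Complex.add_conj]
    simp only [Tetrad.frame, Tetrad.rotate, Fin.sum_univ_four, E', Matrix.cons_val,
      Complex.ofReal_mul, Complex.ofReal_sub, Complex.ofReal_add, ← Complex.mul_conj]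
    push_cast at this
    simp only [map_mul] at this
    push_cast
    linear_combination (-Complex.exp (-(a x : ℂ))) * this
  have f2 : (T.rotate a b p).frame 2 x
      = fun i => ∑ k, (![-(s * (starRingEnd ℂ) (p x)), 0, s, 0] : Fin 4 → ℂ) k * T.frame k x i := by
    ext i
    simp [Tetrad.frame, Tetrad.rotate, Fin.sum_univ_four, ← hs]
    ring
  have f3 : (T.rotate a b p).frame 3 x
      = fun i => ∑ k, (![-((starRingEnd ℂ) s * p x), 0, 0, (starRingEnd ℂ) s] : Fin 4 → ℂ) k
          * T.frame k x i := by
    ext i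
    simp only [Tetrad.frame, Tetrad.rotate, Fin.sum_univ_four, ← hs, Matrix.cons_val, map_mul,
      map_sub, Complex.conj_conj, Complex.conj_ofReal]
    ring
  have key : ∀ c d, evalTensor (formK4 g (T.rotate a b p) k₁ k₂ k₇ x) (T.frame c x) (T.frame d x)
      = frameK4 (k₁ x) (k₂ x) (k₇ x) c d := fun c d => by rw [hK, h.formK4_frame hx]
  have k22 := key 2 2
  have k21 := key 2 1
  simp only [evalTensor_formK4, f0, f1, f2, f3, inner_linear, h.inner_frame x hx]
    at k22 k21
  simp [eta, frameK4, Fin.sum_univ_four] at k22 k21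
  have hs2 : (starRingEnd ℂ) s * (starRingEnd ℂ) s = 1 := by
    have h7' : (k₇ x : ℂ) ≠ 0 := by exact_mod_cast h7
    apply mul_left_cancel₀ h7'
    linear_combination k22
  refine ⟨?_, ?_⟩
  · have : (starRingEnd ℂ) (p x) = 0 := by
      refine eq_zero_of_conj_relation hp hm ?_
      rw [Complex.conj_conj]
      push_cast
      linear_combination k21 - (k₁ x) * (starRingEnd ℂ) (p x) * hee
        - k₂ x * (starRingEnd ℂ) (p x) * hss - k₇ x * p x * hs2
    simpa using this
  · have him : s.im = Real.sin (b x) := by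
      rw [hs, mul_comm, Complex.exp_ofReal_mul_I_im]
    rw [← him]
    have hs1 : (starRingEnd ℂ) s = s := by
      linear_combination s * hs2 - (starRingEnd ℂ) s * hss
    exact Complex.conj_eq_iff_im.1 hs1

end Rotation

section Rescaling

variable {U : Set Point} {g : Metric} {T T' : Tetrad} {x : Point} {F : Fin 4 → Point → ℂ}

theorem struct_rescale (h : IsNullTetrad U g T) (hU : IsOpen U) (hx : x ∈ U)
    (hF : ∀ a, DifferentiableAt ℝ (F a) x)
    (hT : ∀ y ∈ U, ∀ a i, T'.frame a y i = F a y * T.frame a y i) (a b k : Fin 4) :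
    struct g T' a b k x = F a x * F b x * F k x * struct g T a b k x
      + F a x * dirDeriv (T.frame a x) (F b) x * F k x * eta b k
      - F b x * dirDeriv (T.frame b x) (F a) x * F k x * eta a k := by
  have hfr : ∀ a i, DifferentiableAt ℝ (fun y => T.frame a y i) x :=
    fun a i => (h.contDiffOn_frame a i).differentiableAt_of_isOpen hU hx
  have hd : ∀ (c : ℂ) (v : Fin 4 → ℂ) (φ : Point → ℂ),
      dirDeriv (fun i => c * v i) φ x = c * dirDeriv v φ x := by
    intro c v φ
    simp only [dirDeriv, Finset.mul_sum]
    exact Finset.sum_congr rfl fun i _ => by ring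
  have hb : ∀ i, bracket (T'.frame a) (T'.frame b) x i
      = F a x * F b x * bracket (T.frame a) (T.frame b) x i
        + F a x * dirDeriv (T.frame a x) (F b) x * T.frame b x i
        - F b x * dirDeriv (T.frame b x) (F a) x * T.frame a x i := by
    intro i
    have e : ∀ c, T'.frame c x = fun j => F c x * T.frame c x j :=
      fun c => funext fun j => hT x hx c j
    simp only [bracket]
    rw [dirDeriv_congr hU hx fun y hy => hT y hy b i, dirDeriv_congr hU hx fun y hy => hT y hy a i,
      e, e, hd, hd, dirDeriv_mul (hF _) (hfr _ _), dirDeriv_mul (hF _) (hfr _ _)]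
    ring
  simp only [struct, ← h.inner_frame x hx, Metric.inner, evalTensor, hb, hT x hx, Finset.mul_sum,
    ← Finset.sum_add_distrib, ← Finset.sum_sub_distrib]
  exact Finset.sum_congr rfl fun i _ => Finset.sum_congr rfl fun j _ => by ring

theorem conn_rescale (h : IsNullTetrad U g T) (hU : IsOpen U) (hx : x ∈ U)
    (hF : ∀ a, DifferentiableAt ℝ (F a) x) (h01 : F 0 x * F 1 x = 1) (h23 : F 2 x * F 3 x = 1)
    {A : Fin 4 → ℂ} (hF0 : ∀ c, dirDeriv (T.frame c x) (F 0) x = F 0 x * A c)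
    (hF1 : ∀ c, dirDeriv (T.frame c x) (F 1) x = -(F 1 x * A c))
    (hF2 : ∀ c, dirDeriv (T.frame c x) (F 2) x = 0)
    (hF3 : ∀ c, dirDeriv (T.frame c x) (F 3) x = 0)
    (hT : ∀ y ∈ U, ∀ a i, T'.frame a y i = F a y * T.frame a y i) (c : Fin 4) :
    conn g T' c 0 1 x = F c x * (conn g T c 0 1 x + A c) ∧
      conn g T' c 2 3 x = F c x * conn g T c 2 3 x := by
  simp only [conn, struct_rescale h hU hx hF hT]
  fin_cases c <;> simp [eta, hF0, hF1, hF2, hF3] <;> constructor <;> grind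

end Rescaling

/-- The connection forms `g(∇l, n)` and `g(∇m, m̄)` of a boosted tetrad without `ε, γ, α, β`. -/
structure IsBoostFlat (U : Set Point) (g : Metric) (T : Tetrad) (φ : Point → ℂ) : Prop where
  smooth : ContDiffOn ℝ ∞ φ U
  conn01 : ∀ x ∈ U, ∀ c, conn g T c 0 1 x = -dirDeriv (T.frame c x) φ x
  conn23 : ∀ x ∈ U, ∀ c, conn g T c 2 3 x = 0

theorem IsAdaptedRotation.isBoostFlat {U : Set Point} {g : Metric} {T : Tetrad}
    {k₁ k₂ k₇ : Point → ℝ} {a b : Point → ℝ} {p : Point → ℂ} (hU : IsOpen U)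
    (h : IsNullTetrad U g T) (hR : IsAdaptedRotation U g T k₁ k₂ k₇ a b p)
    (hpb : ∀ x ∈ U, p x = 0 ∧ Real.sin (b x) = 0) :
    IsBoostFlat U g T (fun x => (a x : ℂ)) := by
  have hr : ContDiff ℝ ∞ (fun r : ℝ => (r : ℂ)) := Complex.ofRealCLM.contDiff
  have ha : ContDiffOn ℝ ∞ (fun x => (a x : ℂ)) U := hr.comp_contDiffOn hR.smooth_a
  set s : Point → ℂ := fun x => (Real.cos (b x) : ℂ) with hs
  set F : Fin 4 → Point → ℂ := ![fun x => Complex.exp (a x), fun x => Complex.exp (-a x), s, s]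
    with hFdef
  have hsd : ContDiffOn ℝ ∞ s U :=
    hr.comp_contDiffOn (Real.contDiff_cos.comp_contDiffOn hR.smooth_b)
  have hs2 : ∀ x ∈ U, s x * s x = 1 := by
    intro x hx
    have := Real.sin_sq_add_cos_sq (b x)
    rw [(hpb x hx).2] at this
    simp only [hs]
    rw [← Complex.ofReal_mul, ← sq]
    have hc : Real.cos (b x) ^ 2 = 1 := by linarith
    rw [hc, Complex.ofReal_one]
  have hexp : ∀ x ∈ U, Complex.exp (Complex.I * (b x : ℂ)) = s x := by
    intro x hx
    rw [mul_comm, Complex.exp_mul_I, ← Complex.ofReal_cos, ← Complex.ofReal_sin, (hpb x hx).2]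
    simp [hs]
  have hT : ∀ y ∈ U, ∀ c i, (T.rotate a b p).frame c y i = F c y * T.frame c y i := by
    intro y hy c i
    have hconj : (starRingEnd ℂ) (s y) = s y := Complex.conj_ofReal _
    fin_cases c <;>
      simp [Tetrad.frame, Tetrad.rotate, hFdef, (hpb y hy).1, hexp y hy, hconj]
  have key : ∀ x ∈ U, ∀ c,
      conn g (T.rotate a b p) c 0 1 x
          = F c x * (conn g T c 0 1 x + dirDeriv (T.frame c x) (fun x => (a x : ℂ)) x) ∧
        conn g (T.rotate a b p) c 2 3 x = F c x * conn g T c 2 3 x := by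
    intro x hx c
    have had := ha.differentiableAt_of_isOpen hU hx
    have hsx := hsd.differentiableAt_of_isOpen hU hx
    have hs0 : ∀ c, dirDeriv (T.frame c x) s x = 0 := by
      intro c
      have h1 := dirDeriv_eq_zero (v := T.frame c x) hU hx hs2
      rw [dirDeriv_mul hsx hsx] at h1
      have h2 := hs2 x hx
      linear_combination (1 / 2) * s x * h1 - dirDeriv (T.frame c x) s x * h2
    refine conn_rescale (A := fun c => dirDeriv (T.frame c x) (fun x => (a x : ℂ)) x) h hU hx
      ?_ ?_ (hs2 x hx) ?_ ?_ hs0 hs0 hT c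
    · intro c
      fin_cases c
      · exact had.cexp
      · exact had.fun_neg.cexp
      · exact hsx
      · exact hsx
    · simp [hFdef, ← Complex.exp_add]
    · intro c
      exact dirDeriv_exp had
    · intro c
      refine (dirDeriv_exp had.fun_neg).trans ?_
      rw [dirDeriv_neg, mul_neg]
      rfl
  have hne : ∀ x ∈ U, ∀ c, F c x ≠ 0 := by
    intro x hx c
    have hs0 : s x ≠ 0 := fun h0 => by simpa [h0] using hs2 x hx
    fin_cases c <;> simp [hFdef, hs0]
  have hXY : ∀ x ∈ U, ∀ c, conn g T c 0 1 x + dirDeriv (T.frame c x) (fun x => (a x : ℂ)) x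
      = conn g T c 2 3 x := by
    intro x hx c
    have hz : (1 / 2) * (conn g (T.rotate a b p) c 0 1 x - conn g (T.rotate a b p) c 2 3 x) = 0 := by
      fin_cases c
      · exact hR.epsilon_eq x hx
      · exact hR.gamma_eq x hx
      · exact hR.beta_eq x hx
      · exact hR.alpha_eq x hx
    rw [(key x hx c).1, (key x hx c).2] at hz
    apply mul_left_cancel₀ (hne x hx c)
    linear_combination 2 * hz
  have hXY' : ∀ x ∈ U, ∀ c, conn g T c 0 1 x + dirDeriv (T.frame c x) (fun x => (a x : ℂ)) x
      = -conn g T c 2 3 x := by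
    intro x hx c
    have := congrArg (starRingEnd ℂ) (hXY x hx (conjIndex c))
    have hcc : conjIndex (conjIndex c) = c := by fin_cases c <;> rfl
    rw [map_add, conj_conn, conj_conn, conj_dirDeriv_frame, hcc] at this
    rw [← conn_antisymm]
    simpa [conjIndex] using this
  refine ⟨ha, fun x hx c => ?_, fun x hx c => ?_⟩
  · linear_combination (1 / 2) * hXY x hx c + (1 / 2) * hXY' x hx c
  · linear_combination (1 / 2) * hXY' x hx c - (1 / 2) * hXY x hx c

/-! ### The field equations in a boosted tetrad without `ε, γ, α, β, κ, ν, π` -/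

/-- A vacuum null tetrad with `κ = ν = π = 0`, a boost of which annihilates `ε, γ, α, β`. -/
structure IsReducedTetrad (U : Set Point) (g : Metric) (T : Tetrad) (Λ : ℝ) (φ : Point → ℂ) :
    Prop where
  isOpen : IsOpen U
  tetrad : IsNullTetrad U g T
  flat : IsBoostFlat U g T φ
  vacuum : IsVacuum g T U Λ
  conn002 : ∀ x ∈ U, conn g T 0 0 2 x = 0
  conn113 : ∀ x ∈ U, conn g T 1 1 3 x = 0
  conn013 : ∀ x ∈ U, conn g T 0 1 3 x = 0

namespace IsReducedTetrad

variable {U : Set Point} {g : Metric} {T : Tetrad} {Λ : ℝ} {φ : Point → ℂ} {x : Point}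

theorem conn003 (h : IsReducedTetrad U g T Λ φ) (hx : x ∈ U) : conn g T 0 0 3 x = 0 := by
  have := conj_conn (g := g) (T := T) (x := x) 0 0 2
  rw [h.conn002 x hx, map_zero] at this
  exact this.symm

theorem conn112 (h : IsReducedTetrad U g T Λ φ) (hx : x ∈ U) : conn g T 1 1 2 x = 0 := by
  have := conj_conn (g := g) (T := T) (x := x) 1 1 3
  rw [h.conn113 x hx, map_zero] at this
  exact this.symm

theorem conn012 (h : IsReducedTetrad U g T Λ φ) (hx : x ∈ U) : conn g T 0 1 2 x = 0 := by
  have := conj_conn (g := g) (T := T) (x := x) 0 1 3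
  rw [h.conn013 x hx, map_zero] at this
  exact this.symm

theorem riemann01 (h : IsReducedTetrad U g T Λ φ) (hx : x ∈ U) (c d : Fin 4) :
    riemann g T 0 1 c d x = ∑ f, ∑ k, eta f k * (conn g T d 0 k x * conn g T c f 1 x
        - conn g T c 0 k x * conn g T d f 1 x) := by
  have hc := h.tetrad.commutator h.isOpen hx h.flat.smooth c d
  rw [riemann_eq, dirDeriv_congr h.isOpen hx fun y hy => h.flat.conn01 y hy d,
    dirDeriv_congr h.isOpen hx fun y hy => h.flat.conn01 y hy c, dirDeriv_neg, dirDeriv_neg]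
  simp only [eta_sum_mul] at hc
  simp only [eta_sum, h.flat.conn01 x hx]
  linear_combination -hc

theorem riemann23 (h : IsReducedTetrad U g T Λ φ) (hx : x ∈ U) (c d : Fin 4) :
    riemann g T 2 3 c d x = ∑ f, ∑ k, eta f k * (conn g T d 2 k x * conn g T c f 3 x
        - conn g T c 2 k x * conn g T d f 3 x) := by
  rw [riemann_eq, dirDeriv_eq_zero h.isOpen hx fun y hy => h.flat.conn23 y hy d,
    dirDeriv_eq_zero h.isOpen hx fun y hy => h.flat.conn23 y hy c]
  simp only [h.flat.conn23 x hx, mul_zero, sub_zero, zero_add]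

theorem conn_table (h : IsReducedTetrad U g T Λ φ) (hx : x ∈ U) :
    (conn g T 0 0 2 x = 0 ∧ conn g T 0 0 3 x = 0 ∧ conn g T 1 1 2 x = 0 ∧ conn g T 1 1 3 x = 0 ∧
      conn g T 0 1 2 x = 0 ∧ conn g T 0 1 3 x = 0) ∧
    (∀ c, conn g T c 2 3 x = 0) ∧ (∀ c a, conn g T c a a x = 0) ∧
    (∀ c, conn g T c 1 0 x = -conn g T c 0 1 x) ∧ (∀ c, conn g T c 2 0 x = -conn g T c 0 2 x) ∧
    (∀ c, conn g T c 3 0 x = -conn g T c 0 3 x) ∧ (∀ c, conn g T c 2 1 x = -conn g T c 1 2 x) ∧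
    (∀ c, conn g T c 3 1 x = -conn g T c 1 3 x) ∧ (∀ c, conn g T c 3 2 x = 0) := by
  refine ⟨⟨h.conn002 x hx, h.conn003 hx, h.conn112 hx, h.conn113 x hx, h.conn012 hx,
    h.conn013 x hx⟩, h.flat.conn23 x hx, fun c a => conn_self c a, fun c => conn_antisymm c 1 0,
    fun c => conn_antisymm c 2 0, fun c => conn_antisymm c 3 0, fun c => conn_antisymm c 2 1,
    fun c => conn_antisymm c 3 1, fun c => ?_⟩
  rw [conn_antisymm, h.flat.conn23 x hx, neg_zero]

theorem ricci_eq (b d : Fin 4) : ricci g T b d x = riemann g T 0 b 1 d x + riemann g T 1 b 0 d x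
    - riemann g T 2 b 3 d x - riemann g T 3 b 2 d x :=
  eta_sum fun a c => riemann g T a b c d x

theorem scalar_eq (h : IsReducedTetrad U g T Λ φ) (hx : x ∈ U) : scalar g T x = 24 * Λ := by
  have : scalar g T x = ricci g T 0 1 x + ricci g T 1 0 x - ricci g T 2 3 x - ricci g T 3 2 x :=
    eta_sum fun b d => ricci g T b d x
  rw [this]
  simp only [h.vacuum x hx]
  simp [eta]
  ring

theorem weyl_eq (h : IsReducedTetrad U g T Λ φ) (hx : x ∈ U) (a b c d : Fin 4) :
    weyl g T a b c d x = riemann g T a b c d x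
      - 2 * Λ * (eta a c * eta b d - eta a d * eta b c) := by
  simp only [weyl, h.scalar_eq hx, h.vacuum x hx]
  ring

theorem riemann_values (h : IsReducedTetrad U g T Λ φ) (hx : x ∈ U) :
    riemann g T 0 1 2 3 x = 0 ∧ riemann g T 2 3 2 3 x = 0 ∧ riemann g T 0 2 1 3 x = -3 * Λ ∧
      riemann g T 1 3 0 2 x = -3 * Λ ∧ riemann g T 0 1 1 3 x + riemann g T 2 3 1 3 x = 0 ∧
      riemann g T 0 2 0 3 x = 0 ∧ riemann g T 1 3 0 3 x = 0 ∧ riemann g T 1 3 1 2 x = 0 ∧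
      riemann g T 0 2 1 2 x = 0 ∧ riemann g T 0 1 0 1 x = 0 ∧ riemann g T 0 1 0 2 x = 0 := by
  have t := h.conn_table hx
  have p0102 := h.riemann01 hx 0 2
  have p0101 := h.riemann01 hx 0 1
  have p2301 := h.riemann23 hx 0 1
  simp [eta_sum, t] at p0102 p0101 p2301
  rw [mul_comm, sub_self] at p0101 p0102
  have r := fun a b c d => riemann_antisymm_right (g := g) (T := T) (x := x) a b c d
  have l := fun a b c d => riemann_antisymm_left (g := g) (T := T) (x := x) a b c d
  have s := h.tetrad.riemann_pair_symm h.isOpen hx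
  have bi := h.tetrad.bianchi h.isOpen hx 2 0 1 3
  have v := fun b d => (ricci_eq b d).symm.trans (h.vacuum x hx b d)
  have v01 := v 0 1
  have v23 := v 2 3
  have v13 := v 1 3
  have v00 := v 0 0
  have v33 := v 3 3
  have v11 := v 1 1
  have v22 := v 2 2
  simp [eta] at v01 v23 v13 v00 v33 v11 v22
  have e0123 : riemann g T 0 1 2 3 x = 0 := by rw [s, p2301]
  have z1 := fun a c d => l a a c d
  have z2 := fun a b c => r a b c c
  have w0 := s 0 2 0 3
  have w1 := s 1 3 0 2
  have w2 := s 3 1 2 3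
  have w3 := s 0 3 1 3
  have w4 := s 2 1 3 1
  have w5 := s 0 2 1 2
  have w6 := s 0 3 1 2
  refine ⟨e0123, ?_, ?_, ?_, ?_, ?_, ?_, ?_, ?_, p0101, p0102⟩ <;> grind

theorem mu_mul_rho (h : IsReducedTetrad U g T Λ φ) (hx : x ∈ U) :
    conn g T 2 1 3 x * conn g T 3 0 2 x = conn g T 2 0 2 x * conn g T 3 1 3 x := by
  have t := h.conn_table hx
  obtain ⟨h1, h2, -⟩ := h.riemann_values hx
  rw [h.riemann01 hx] at h1
  rw [h.riemann23 hx] at h2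
  simp only [eta_sum, t] at h1 h2
  linear_combination (1 / 2) * h1 - (1 / 2) * h2

theorem mu_mul_tau (h : IsReducedTetrad U g T Λ φ) (hx : x ∈ U) :
    conn g T 2 1 3 x * conn g T 1 0 2 x = 0 := by
  have t := h.conn_table hx
  obtain ⟨-, -, -, -, h1, -⟩ := h.riemann_values hx
  rw [h.riemann01 hx, h.riemann23 hx] at h1
  simp only [eta_sum, t] at h1
  have h2 : conn g T 3 1 2 x * conn g T 1 0 3 x = 0 := by linear_combination (-1 / 2) * h1
  have := congrArg (starRingEnd ℂ) h2
  rw [map_mul, conj_conn, conj_conn, map_zero] at this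
  exact this

/-- The Newman-Penrose equations with derivatives. -/
theorem derivative_equations (h : IsReducedTetrad U g T Λ φ) (hx : x ∈ U) :
    (dirDeriv (T.frame 0 x) (conn g T 3 0 2) x = conn g T 0 0 1 x * conn g T 3 0 2 x
        + conn g T 3 0 2 x ^ 2 + conn g T 2 0 2 x * conn g T 3 0 3 x) ∧
    (dirDeriv (T.frame 0 x) (conn g T 2 0 2) x = psi0 g T x + conn g T 0 0 1 x * conn g T 2 0 2 x
        + (conn g T 3 0 2 x + conn g T 2 0 3 x) * conn g T 2 0 2 x) ∧
    (dirDeriv (T.frame 0 x) (conn g T 3 1 3) x = -(conn g T 0 0 1 x * conn g T 3 1 3 x)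
        + conn g T 3 0 2 x * conn g T 3 1 3 x + conn g T 3 0 3 x * conn g T 2 1 3 x) ∧
    (dirDeriv (T.frame 0 x) (conn g T 2 1 3) x = -(conn g T 0 0 1 x * conn g T 2 1 3 x)
        + conn g T 2 0 2 x * conn g T 3 1 3 x + conn g T 2 0 3 x * conn g T 2 1 3 x - 3 * Λ) ∧
    (dirDeriv (T.frame 1 x) (conn g T 2 1 3) x = -(conn g T 1 0 1 x * conn g T 2 1 3 x)
        + conn g T 2 1 3 x ^ 2 + conn g T 3 1 3 x * conn g T 2 1 2 x) ∧
    (dirDeriv (T.frame 1 x) (conn g T 3 1 3) x = psi4 g T x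
        - conn g T 1 0 1 x * conn g T 3 1 3 x
        + (conn g T 2 1 3 x + conn g T 3 1 2 x) * conn g T 3 1 3 x) ∧
    (dirDeriv (T.frame 1 x) (conn g T 2 0 2) x = dirDeriv (T.frame 2 x) (conn g T 1 0 2) x
        - conn g T 1 0 2 x ^ 2 + conn g T 1 0 1 x * conn g T 2 0 2 x
        + conn g T 3 0 2 x * conn g T 2 1 2 x + conn g T 2 0 2 x * conn g T 2 1 3 x) ∧
    (dirDeriv (T.frame 1 x) (conn g T 3 0 2) x = dirDeriv (T.frame 3 x) (conn g T 1 0 2) x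
        - conn g T 1 0 2 x * conn g T 1 0 3 x + conn g T 1 0 1 x * conn g T 3 0 2 x
        + conn g T 3 0 2 x * conn g T 3 1 2 x + conn g T 2 0 2 x * conn g T 3 1 3 x
        - 3 * Λ) := by
  have t := h.conn_table hx
  have d002 := fun c => dirDeriv_eq_zero (v := T.frame c x) h.isOpen hx h.conn002
  have d113 := fun c => dirDeriv_eq_zero (v := T.frame c x) h.isOpen hx h.conn113
  have d013 := fun c => dirDeriv_eq_zero (v := T.frame c x) h.isOpen hx h.conn013
  obtain ⟨-, -, q0213, q1302, -, q0203, q1303, q1312, q0212, -⟩ := h.riemann_values hx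
  have q0202 := h.weyl_eq hx 0 2 0 2
  have q1313 := h.weyl_eq hx 1 3 1 3
  rw [riemann_eq] at q0213 q1302 q0203 q1303 q1312 q0212 q0202 q1313
  simp only [eta_sum, conn_torsionFree, t, d002, d113, d013]
    at q0213 q1302 q0203 q1303 q1312 q0212 q0202 q1313
  simp [eta] at q0202 q1313
  simp only [psi0, psi4]
  refine ⟨?_, ?_, ?_, ?_, ?_, ?_, ?_, ?_⟩
  · linear_combination q0203
  · linear_combination -q0202
  · linear_combination q1303
  · linear_combination q1302
  · linear_combination q1312
  · linear_combination -q1313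
  · linear_combination q0212
  · linear_combination q0213

theorem eq_zero_of_mu_eq_zero (h : IsReducedTetrad U g T Λ φ) (hx : x ∈ U)
    (hM : ∀ᶠ y in 𝓝 x, conn g T 2 1 3 y = 0) : conn g T 3 1 3 x = 0 ∧ (Λ : ℂ) = 0 := by
  have hd : ∀ v, dirDeriv v (conn g T 2 1 3) x = 0 := by
    intro v
    obtain ⟨V, hV, hVo, hxV⟩ := eventually_nhds_iff.1 hM
    exact dirDeriv_eq_zero hVo hxV hV
  obtain ⟨-, -, -, h4, h5, -⟩ := h.derivative_equations hx
  rw [hd, hM.self_of_nhds] at h4 h5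
  have hL : conn g T 3 1 3 x = 0 := by
    have hc : conn g T 2 1 2 x = (starRingEnd ℂ) (conn g T 3 1 3 x) := (conj_conn 3 1 3).symm
    have : conn g T 3 1 3 x * (starRingEnd ℂ) (conn g T 3 1 3 x) = 0 := by
      rw [← hc]
      linear_combination -h5
    simpa using this
  refine ⟨hL, ?_⟩
  rw [hL] at h4
  linear_combination (1 / 3) * h4

theorem tau_mul_lambda (h : IsReducedTetrad U g T Λ φ) (hx : x ∈ U) :
    conn g T 1 0 2 x * conn g T 3 1 3 x = 0 := by
  by_contra hne
  have hcont : ContinuousAt (fun y => conn g T 1 0 2 y * conn g T 3 1 3 y) x :=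
    ((h.tetrad.differentiableAt_conn h.isOpen hx 1 0 2).continuousAt).mul
      (h.tetrad.differentiableAt_conn h.isOpen hx 3 1 3).continuousAt
  have hM : ∀ᶠ y in 𝓝 x, conn g T 2 1 3 y = 0 := by
    filter_upwards [hcont.eventually_ne hne, h.isOpen.mem_nhds hx] with y hy hyU
    exact (mul_eq_zero.1 (h.mu_mul_tau hyU)).resolve_right fun h0 => hy (by rw [h0, zero_mul])
  exact hne (by rw [(h.eq_zero_of_mu_eq_zero hx hM).1, mul_zero])

theorem psi_values (h : IsReducedTetrad U g T Λ φ) (hx : x ∈ U) :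
    psi1 g T x = 0 ∧ psi3 g T x = 0 ∧ psi2 g T x = Λ := by
  have t := h.conn_table hx
  obtain ⟨q0123, -, -, -, -, -, -, -, -, q0101, q0102⟩ := h.riemann_values hx
  refine ⟨?_, ?_, ?_⟩
  · rw [psi1, h.weyl_eq hx, q0102]
    simp [eta]
  · have q := h.riemann01 hx 1 3
    simp only [eta_sum, t] at q
    have hc := congrArg (starRingEnd ℂ) (h.mu_mul_tau hx)
    rw [map_mul, conj_conn, conj_conn, map_zero] at hc
    change conn g T 3 1 2 x * conn g T 1 0 3 x = 0 at hc
    rw [psi3, h.weyl_eq hx, riemann_antisymm_left, q]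
    simp only [eta, Matrix.of_apply, Matrix.cons_val]
    linear_combination h.tau_mul_lambda hx + hc
  · rw [psi2, h.weyl_eq hx, h.weyl_eq hx, q0123, q0101]
    simp [eta]

theorem psi0_mul_lambda (h : IsReducedTetrad U g T Λ φ) (hx : x ∈ U) :
    psi0 g T x * conn g T 3 1 3 x = -3 * Λ * conn g T 3 0 2 x := by
  have hd := fun a b k => h.tetrad.differentiableAt_conn h.isOpen hx a b k
  have e := dirDeriv_congr (v := T.frame 0 x) h.isOpen hx fun y hy => h.mu_mul_rho hy
  rw [dirDeriv_mul (hd _ _ _) (hd _ _ _), dirDeriv_mul (hd _ _ _) (hd _ _ _)] at e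
  obtain ⟨h1, h2, h3, h4, -⟩ := h.derivative_equations hx
  rw [h1, h2, h3, h4] at e
  have k := h.mu_mul_rho hx
  linear_combination -e + (conn g T 3 0 2 x + conn g T 2 0 3 x) * k

theorem psi4_mul_sigma (h : IsReducedTetrad U g T Λ φ) (hx : x ∈ U)
    (hτ : ∀ᶠ y in 𝓝 x, conn g T 1 0 2 y = 0) :
    psi4 g T x * conn g T 2 0 2 x = -3 * Λ * conn g T 2 1 3 x := by
  have hd := fun a b k => h.tetrad.differentiableAt_conn h.isOpen hx a b k
  have hdτ : ∀ v, dirDeriv v (conn g T 1 0 2) x = 0 := by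
    intro v
    obtain ⟨V, hV, hVo, hxV⟩ := eventually_nhds_iff.1 hτ
    exact dirDeriv_eq_zero hVo hxV hV
  have e := dirDeriv_congr (v := T.frame 1 x) h.isOpen hx fun y hy => h.mu_mul_rho hy
  rw [dirDeriv_mul (hd _ _ _) (hd _ _ _), dirDeriv_mul (hd _ _ _) (hd _ _ _)] at e
  obtain ⟨-, -, -, -, h5, h6, h7, h8⟩ := h.derivative_equations hx
  rw [h5, h6, h7, h8, hdτ, hdτ, hτ.self_of_nhds] at e
  have k := h.mu_mul_rho hx
  linear_combination -e + (conn g T 2 1 3 x + conn g T 3 1 2 x) * k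

theorem relations_of_mu_ne_zero (h : IsReducedTetrad U g T Λ φ) (hx : x ∈ U)
    (hρ : conn g T 3 0 2 x ≠ 0) (hM : conn g T 2 1 3 x ≠ 0) :
    conn g T 1 0 2 x = 0 ∧ conn g T 2 0 2 x ≠ 0 ∧
      psi0 g T x * psi4 g T x = (3 * psi2 g T x) ^ 2 ∧
      ((Λ : ℂ) = 0 → psi0 g T x = 0 ∧ psi4 g T x = 0) := by
  have hτ : ∀ᶠ y in 𝓝 x, conn g T 1 0 2 y = 0 := by
    filter_upwards [(h.tetrad.differentiableAt_conn h.isOpen hx 2 1 3).continuousAt.eventually_ne hM,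
      h.isOpen.mem_nhds hx] with y hy hyU
    exact (mul_eq_zero.1 (h.mu_mul_tau hyU)).resolve_left hy
  have k := h.mu_mul_rho hx
  have hne : conn g T 2 0 2 x * conn g T 3 1 3 x ≠ 0 := k ▸ mul_ne_zero hM hρ
  have hσ := left_ne_zero_of_mul hne
  have hL := right_ne_zero_of_mul hne
  have e0 := h.psi0_mul_lambda hx
  have e4 := h.psi4_mul_sigma hx hτ
  refine ⟨hτ.self_of_nhds, hσ, ?_, fun hΛ => ⟨?_, ?_⟩⟩
  · rw [(h.psi_values hx).2.2]
    apply mul_right_cancel₀ hne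
    linear_combination psi4 g T x * conn g T 2 0 2 x * e0 - 3 * Λ * conn g T 3 0 2 x * e4
      + 9 * Λ ^ 2 * k
  · rw [hΛ] at e0
    simpa [hL] using e0
  · rw [hΛ] at e4
    simpa [hσ] using e4

theorem continuousAt_psi (h : IsReducedTetrad U g T Λ φ) (hx : x ∈ U) :
    ContinuousAt (psi0 g T) x ∧ ContinuousAt (psi4 g T) x := by
  have hr : ∀ a b c d, ContinuousAt (riemann g T a b c d) x := fun a b c d =>
    ((h.tetrad.contDiffOn_riemann h.isOpen a b c d).differentiableAt_of_isOpen
      h.isOpen hx).continuousAt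
  have hU := h.isOpen.mem_nhds hx
  refine ⟨(hr 0 2 0 2).congr ?_, (hr 1 3 1 3).congr ?_⟩
  · filter_upwards [hU] with y hy
    rw [psi0, h.weyl_eq hy]
    simp [eta]
  · filter_upwards [hU] with y hy
    rw [psi4, h.weyl_eq hy]
    simp [eta]

theorem relations_of_frequently (h : IsReducedTetrad U g T Λ φ) (hx : x ∈ U)
    (hρ : ∀ y ∈ U, conn g T 3 0 2 y ≠ 0) (hM : ∃ᶠ y in 𝓝 x, conn g T 2 1 3 y ≠ 0) :
    psi0 g T x * psi4 g T x = (3 * psi2 g T x) ^ 2 ∧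
      ((Λ : ℂ) = 0 → psi0 g T x = 0 ∧ psi4 g T x = 0) := by
  obtain ⟨c0, c4⟩ := h.continuousAt_psi hx
  have hf := hM.and_eventually (h.isOpen.mem_nhds hx)
  have hlim : ∀ (F : Point → ℂ) (c : ℂ), ContinuousAt F x →
      (∀ y ∈ U, conn g T 2 1 3 y ≠ 0 → F y = c) → F x = c := fun F c hF hy =>
    isClosed_singleton.mem_of_frequently_of_tendsto (s := {c})
      (hf.mono fun y hy' => hy y hy'.2 hy'.1) hF
  refine ⟨?_, fun hΛ => ⟨?_, ?_⟩⟩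
  · rw [(h.psi_values hx).2.2]
    refine hlim (fun y => psi0 g T y * psi4 g T y) _ (c0.mul c4) fun y hy hy' => ?_
    have := (h.relations_of_mu_ne_zero hy (hρ y hy) hy').2.2.1
    rwa [(h.psi_values hy).2.2] at this
  · exact hlim _ _ c0 fun y hy hy' => ((h.relations_of_mu_ne_zero hy (hρ y hy) hy').2.2.2 hΛ).1
  · exact hlim _ _ c4 fun y hy hy' => ((h.relations_of_mu_ne_zero hy (hρ y hy) hy').2.2.2 hΛ).2

end IsReducedTetrad

/-! ### Petrov types of the reduced tetrads -/

section Petrov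

variable {g : Metric} {T : Tetrad} {x : Point}

theorem isPetrovN_of_psi (h1 : psi1 g T x = 0) (h2 : psi2 g T x = 0) (h3 : psi3 g T x = 0)
    (h4 : psi4 g T x = 0) (hO : ¬ IsPetrovO g T x) : IsPetrovN g T x := by
  have h0 : psi0 g T x ≠ 0 := fun h0 => hO fun s t => by simp [weylQuartic, h0, h1, h2, h3, h4]
  obtain ⟨a, ha⟩ := IsAlgClosed.exists_pow_nat_eq (psi0 g T x) (n := 4) (by norm_num)
  refine ⟨a, 0, Or.inl fun h => h0 (by rw [← ha, h]; norm_num), fun s t => ?_⟩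
  rw [weylQuartic, h1, h2, h3, h4, ← ha]
  ring

theorem isPetrovD_of_psi (h1 : psi1 g T x = 0) (h2 : psi2 g T x ≠ 0) (h3 : psi3 g T x = 0)
    (h04 : psi0 g T x * psi4 g T x = (3 * psi2 g T x) ^ 2) : IsPetrovD g T x := by
  obtain ⟨a, ha⟩ := IsAlgClosed.exists_pow_nat_eq (psi0 g T x) (n := 4) (by norm_num)
  have ha0 : a ≠ 0 := by
    rintro rfl
    have h0 : psi0 g T x = 0 := by rw [← ha]; norm_num
    rw [h0, zero_mul] at h04
    exact h2 (by simpa using h04.symm)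
  obtain ⟨b, hb⟩ := IsAlgClosed.exists_pow_nat_eq (-(3 * psi2 g T x / a ^ 2)) (n := 2) (by norm_num)
  have hb0 : b ≠ 0 := by
    rintro rfl
    have : 3 * psi2 g T x / a ^ 2 = 0 := by linear_combination hb
    simp [h2, ha0] at this
  have h2' : 3 * psi2 g T x = -(a ^ 2 * b ^ 2) := by
    rw [hb]
    field_simp
  have h4 : psi4 g T x = b ^ 4 := by
    apply mul_left_cancel₀ (pow_ne_zero 4 ha0)
    rw [ha, h04, h2', ← ha]
    ring
  refine ⟨a, b, a, -b, ?_, fun s t => ?_⟩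
  · have : a * -b - b * a = -2 * (a * b) := by ring
    rw [this]
    exact mul_ne_zero (by norm_num) (mul_ne_zero ha0 hb0)
  · rw [weylQuartic, h1, h3, h4, ← ha]
    linear_combination 2 * s ^ 2 * t ^ 2 * h2'

end Petrov

theorem IsK4Solution.isReducedTetrad {U : Set Point} {g : Metric} {T : Tetrad} {Λ : ℝ}
    {k₁ k₂ k₇ : Point → ℝ} {a b : Point → ℝ} {p : Point → ℂ} (hS : IsK4Solution U g T Λ k₁ k₂ k₇)
    (hR : IsAdaptedRotation U g T k₁ k₂ k₇ a b p) (hC : IsClassI U g T) :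
    (∀ x ∈ U, p x = 0 ∧ Real.sin (b x) = 0) ∧ IsReducedTetrad U g T Λ (fun x => (a x : ℂ)) := by
  have hpb : ∀ x ∈ U, p x = 0 ∧ Real.sin (b x) = 0 := by
    intro x hx
    obtain ⟨e1, e2, e3⟩ := hS.eigenvalues_ne x hx
    exact rotate_trivial hS.tetrad hx (fun h => e3 (by rw [h]; ring)) (fun h => e1 (by linarith))
      (fun h => e2 (by linarith)) (hR.invariant x hx)
  exact ⟨hpb, hS.isOpen, hS.tetrad, hR.isBoostFlat hS.isOpen hS.tetrad hpb, hS.vacuum,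
    fun x hx => (hS.conn_eq_zero hx).1, fun x hx => (hS.conn_eq_zero hx).2,
    fun x hx => neg_eq_zero.1 (hC x hx).2⟩

/-- The properties of the solutions of Class I. -/
theorem IsK4Solution.classI {U : Set Point} {g : Metric} {T : Tetrad} {Λ : ℝ}
    {k₁ k₂ k₇ : Point → ℝ} {a b : Point → ℝ} {p : Point → ℂ} (hS : IsK4Solution U g T Λ k₁ k₂ k₇)
    (hR : IsAdaptedRotation U g T k₁ k₂ k₇ a b p) (hC : IsClassI U g T) :
    (∀ x ∈ U, p x = 0 ∧ Real.sin (b x) = 0) ∧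
      (∀ x ∈ U, kappa g T x = 0 ∧ nu g T x = 0 ∧
        psi1 g T x = 0 ∧ psi3 g T x = 0 ∧ psi2 g T x = (Λ : ℂ) ∧
        mu g T x * rho g T x = sigma g T x * lambda g T x ∧
        mu g T x * tau g T x = 0) ∧
      (∀ x ∈ U, (∀ᶠ y in 𝓝 x, mu g T y = 0) →
        lambda g T x = 0 ∧ psi2 g T x = 0 ∧ psi4 g T x = 0 ∧ Λ = 0 ∧
        (¬ IsPetrovO g T x → IsPetrovN g T x)) ∧
      (∀ x ∈ U, mu g T x ≠ 0 →
        tau g T x = 0 ∧ sigma g T x ≠ 0 ∧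
        psi0 g T x * psi4 g T x = (3 * psi2 g T x) ^ 2 ∧
        (¬ IsPetrovO g T x → IsPetrovD g T x)) ∧
      (∀ x ∈ U, ¬ IsPetrovO g T x →
        (IsPetrovN g T x ∨
          (IsPetrovD g T x ∧ psi0 g T x * psi4 g T x = (3 * psi2 g T x) ^ 2)) ∧
        ∃ᶠ y in 𝓝 x, sigma g T y ≠ 0) := by
  obtain ⟨hpb, h⟩ := hS.isReducedTetrad hR hC
  have hρ : ∀ x ∈ U, conn g T 3 0 2 x ≠ 0 := fun x hx => (hC x hx).1
  have hN : ∀ x ∈ U, (∀ᶠ y in 𝓝 x, mu g T y = 0) →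
      lambda g T x = 0 ∧ psi2 g T x = 0 ∧ psi4 g T x = 0 ∧ Λ = 0 ∧
      (¬ IsPetrovO g T x → IsPetrovN g T x) := by
    intro x hx hmu
    have hM : ∀ᶠ y in 𝓝 x, conn g T 2 1 3 y = 0 := hmu.mono fun y hy => neg_eq_zero.1 hy
    obtain ⟨hL, hΛ⟩ := h.eq_zero_of_mu_eq_zero hx hM
    obtain ⟨p1, p3, p2⟩ := h.psi_values hx
    have hL' : ∀ᶠ y in 𝓝 x, conn g T 3 1 3 y = 0 := by
      filter_upwards [hM.eventually_nhds, h.isOpen.mem_nhds hx] with y hy hyU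
      exact (h.eq_zero_of_mu_eq_zero hyU hy).1
    have p4 : psi4 g T x = 0 := by
      obtain ⟨V, hV, hVo, hxV⟩ := eventually_nhds_iff.1 hL'
      obtain ⟨-, -, -, -, -, h6, -⟩ := h.derivative_equations hx
      rw [dirDeriv_eq_zero hVo hxV hV, hL] at h6
      linear_combination -h6
    rw [hΛ] at p2
    exact ⟨neg_eq_zero.2 hL, p2, p4, by exact_mod_cast hΛ, isPetrovN_of_psi p1 p2 p3 p4⟩
  have hDΛ : ∀ x ∈ U, ¬ IsPetrovO g T x → (∃ᶠ y in 𝓝 x, conn g T 2 1 3 y ≠ 0) →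
      IsPetrovD g T x ∧ psi0 g T x * psi4 g T x = (3 * psi2 g T x) ^ 2 := by
    intro x hx hO hM
    obtain ⟨p1, p3, p2⟩ := h.psi_values hx
    obtain ⟨hr, h0⟩ := h.relations_of_frequently hx hρ hM
    refine ⟨isPetrovD_of_psi p1 (fun hz => hO ?_) p3 hr, hr⟩
    obtain ⟨p0, p4⟩ := h0 (p2 ▸ hz)
    exact fun s t => by simp [weylQuartic, p0, p1, hz, p3, p4]
  refine ⟨hpb, fun x hx => ?_, hN, fun x hx hmu => ?_, fun x hx hO => ?_⟩
  · obtain ⟨p1, p3, p2⟩ := h.psi_values hx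
    refine ⟨h.conn002 x hx, neg_eq_zero.2 (h.conn113 x hx), p1, p3, p2, ?_, ?_⟩
    · simp only [mu, rho, sigma, lambda]
      linear_combination -h.mu_mul_rho hx
    · simp only [mu, tau]
      linear_combination -h.mu_mul_tau hx
  · have hM : conn g T 2 1 3 x ≠ 0 := fun h0 => hmu (neg_eq_zero.2 h0)
    obtain ⟨hτ, hσ, hr, -⟩ := h.relations_of_mu_ne_zero hx (hρ x hx) hM
    refine ⟨hτ, hσ, hr, fun hO => (hDΛ x hx hO ?_).1⟩
    exact ((h.tetrad.differentiableAt_conn h.isOpen hx 2 1 3).continuousAt.eventually_ne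
      hM).frequently
  · by_cases hM : ∃ᶠ y in 𝓝 x, conn g T 2 1 3 y ≠ 0
    · refine ⟨Or.inr (hDΛ x hx hO hM), ?_⟩
      exact (hM.and_eventually (h.isOpen.mem_nhds hx)).mono fun y hy =>
        (h.relations_of_mu_ne_zero hy.2 (hρ y hy.2) hy.1).2.1
    · have hM' : ∀ᶠ y in 𝓝 x, conn g T 2 1 3 y = 0 := by
        simpa [Filter.not_frequently] using hM
      obtain ⟨-, p2, p4, -, hPN⟩ := hN x hx (hM'.mono fun y hy => neg_eq_zero.2 hy)
      refine ⟨Or.inl (hPN hO), fun hσ => hO ?_⟩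
      obtain ⟨p1, p3, -⟩ := h.psi_values hx
      have hσ' : ∀ᶠ y in 𝓝 x, conn g T 2 0 2 y = 0 := hσ.mono fun y hy => not_not.1 hy
      obtain ⟨V, hV, hVo, hxV⟩ := eventually_nhds_iff.1 hσ'
      obtain ⟨-, h2, -⟩ := h.derivative_equations hx
      rw [dirDeriv_eq_zero hVo hxV hV, hV x hxV] at h2
      have p0 : psi0 g T x = 0 := by linear_combination -h2
      exact fun s t => by simp [weylQuartic, p0, p1, p2, p3, p4]

/-! ### The metrics `2 du dv - 2 f² dx² - 2 h² dy²` -/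

/-- The metric `2 dx⁰ dx¹ - 2 f² (dx²)² - 2 h² (dx³)²`. -/
def rosenMetric (f h : Point → ℝ) : Metric := fun x =>
  !![0, 1, 0, 0; 1, 0, 0, 0; 0, 0, -2 * f x ^ 2, 0; 0, 0, 0, -2 * h x ^ 2]

/-- The null tetrad `l = ∂₀`, `n = ∂₁`, `m = (∂₂ / f + i ∂₃ / h) / 2`. -/
noncomputable def rosenTetrad (f h : Point → ℝ) : Tetrad where
  l _ := ![1, 0, 0, 0]
  n _ := ![0, 1, 0, 0]
  m x := ![0, 0, ((2 * f x : ℝ) : ℂ)⁻¹, Complex.I * ((2 * h x : ℝ) : ℂ)⁻¹]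

/-- The profile functions `f`, `h` depend on linear combinations with coefficients `w`, `v` of
`x⁰` and `x¹`, with logarithmic derivatives `p`, `q` such that `p' = s - p²` and `q' = r - q²`. -/
structure IsRosen (U : Set Point) (f h p q : Point → ℝ) (w v : Fin 4 → ℝ) (s r Λ : ℝ) : Prop where
  isOpen : IsOpen U
  smooth_f : ContDiffOn ℝ ∞ f U
  smooth_h : ContDiffOn ℝ ∞ h U
  smooth_p : ContDiffOn ℝ ∞ p U
  smooth_q : ContDiffOn ℝ ∞ q U
  f_ne : ∀ x ∈ U, f x ≠ 0
  h_ne : ∀ x ∈ U, h x ≠ 0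
  deriv_f : ∀ x ∈ U, ∀ i, fderiv ℝ f x (Pi.single i 1) = w i * p x * f x
  deriv_h : ∀ x ∈ U, ∀ i, fderiv ℝ h x (Pi.single i 1) = v i * q x * h x
  deriv_p : ∀ x ∈ U, ∀ i, fderiv ℝ p x (Pi.single i 1) = w i * (s - p x ^ 2)
  deriv_q : ∀ x ∈ U, ∀ i, fderiv ℝ q x (Pi.single i 1) = v i * (r - q x ^ 2)
  w_eq : w 2 = 0 ∧ w 3 = 0
  v_eq : v 2 = 0 ∧ v 3 = 0
  vac00 : s * w 0 ^ 2 + r * v 0 ^ 2 = 0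
  vac11 : s * w 1 ^ 2 + r * v 1 ^ 2 = 0
  vac_w : s * w 0 * w 1 = 3 * Λ
  vac_v : r * v 0 * v 1 = 3 * Λ
  vac_wv : w 0 * v 1 + w 1 * v 0 = 0

/-- The part of the scalar products of the tetrad in the direction `∂₂`. -/
noncomputable def rosenP : Matrix (Fin 4) (Fin 4) ℂ :=
  !![0, 0, 0, 0; 0, 0, 0, 0; 0, 0, 1 / 2, 1 / 2; 0, 0, 1 / 2, 1 / 2]

/-- The part of the scalar products of the tetrad in the direction `∂₃`. -/
noncomputable def rosenQ : Matrix (Fin 4) (Fin 4) ℂ :=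
  !![0, 0, 0, 0; 0, 0, 0, 0; 0, 0, -1 / 2, 1 / 2; 0, 0, 1 / 2, -1 / 2]

theorem dirDeriv_ofReal {r : Point → ℝ} {x : Point} (hr : DifferentiableAt ℝ r x)
    (v : Fin 4 → ℂ) : dirDeriv v (fun y => (r y : ℂ)) x
      = ∑ i, v i * (fderiv ℝ r x (Pi.single i 1) : ℝ) := by
  have h : fderiv ℝ (fun y => (r y : ℂ)) x = Complex.ofRealCLM.comp (fderiv ℝ r x) :=
    (Complex.ofRealCLM.hasFDerivAt.comp x hr.hasFDerivAt).fderiv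
  simp only [dirDeriv, h]
  rfl

theorem ContDiffOn.differentiableAt_real {U : Set Point} {x : Point} {r : Point → ℝ}
    (hr : ContDiffOn ℝ ∞ r U) (hU : IsOpen U) (hx : x ∈ U) : DifferentiableAt ℝ r x :=
  (hr.contDiffAt (hU.mem_nhds hx)).differentiableAt (by simp)

theorem dirDeriv_inv_two_mul {U : Set Point} {x : Point} (hU : IsOpen U) (hx : x ∈ U)
    {r : Point → ℝ} (hr : ContDiffOn ℝ ∞ r U) (hne : ∀ y ∈ U, r y ≠ 0) {w : Fin 4 → ℝ} {p : ℝ}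
    (hd : ∀ i, fderiv ℝ r x (Pi.single i 1) = w i * p * r x) (u : Fin 4 → ℂ) :
    dirDeriv u (fun y => ((2 * r y : ℝ) : ℂ)⁻¹) x
      = -(∑ i, u i * w i) * p * ((2 * r x : ℝ) : ℂ)⁻¹ := by
  have hrd := hr.differentiableAt_real hU hx
  have hne' : ∀ y ∈ U, ((2 * r y : ℝ) : ℂ) ≠ 0 := fun y hy => by simpa using hne y hy
  have d1 : DifferentiableAt ℝ (fun y => ((2 * r y : ℝ) : ℂ)) x :=
    Complex.ofRealCLM.differentiableAt.comp x (hrd.const_mul 2)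
  have d2 : DifferentiableAt ℝ (fun y => ((2 * r y : ℝ) : ℂ)⁻¹) x := d1.inv (hne' x hx)
  have h1 := dirDeriv_eq_zero (v := u) hU hx (φ := fun y =>
    ((2 * r y : ℝ) : ℂ) * ((2 * r y : ℝ) : ℂ)⁻¹) (c := 1) fun y hy => mul_inv_cancel₀ (hne' y hy)
  have h2 : dirDeriv u (fun y => ((2 * r y : ℝ) : ℂ)) x
      = (∑ i, u i * w i) * p * ((2 * r x : ℝ) : ℂ) := by
    rw [dirDeriv_ofReal (hrd.const_mul 2)]
    simp only [fderiv_const_mul hrd, FunLike.coe_smul, Pi.smul_apply, smul_eq_mul,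
      hd, Finset.sum_mul]
    exact Finset.sum_congr rfl fun i _ => by push_cast; ring
  rw [dirDeriv_mul d1 d2, h2] at h1
  apply mul_left_cancel₀ (hne' x hx)
  linear_combination h1

namespace IsRosen

variable {U : Set Point} {f h p q : Point → ℝ} {w v : Fin 4 → ℝ} {s r Λ : ℝ} {x : Point}

theorem tetrad (R : IsRosen U f h p q w v s r Λ) :
    IsNullTetrad U (rosenMetric f h) (rosenTetrad f h) := by
  have hr : ContDiff ℝ ∞ (fun r : ℝ => (r : ℂ)) := Complex.ofRealCLM.contDiff
  refine ⟨fun x _ => ?_, fun i j => ?_, contDiffOn_const, contDiffOn_const, ?_, ?_⟩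
  · ext i j
    fin_cases i <;> fin_cases j <;> rfl
  · have := R.smooth_f
    have := R.smooth_h
    fin_cases i <;> fin_cases j <;> simp [rosenMetric] <;> fun_prop
  · refine contDiffOn_pi.2 fun i => ?_
    have e2 : ContDiffOn ℝ ∞ (fun x => ((2 * f x : ℝ) : ℂ)⁻¹) U :=
      (hr.comp_contDiffOn (contDiffOn_const.mul R.smooth_f)).inv fun x hx => by
        simpa using R.f_ne x hx
    have e3 : ContDiffOn ℝ ∞ (fun x => Complex.I * ((2 * h x : ℝ) : ℂ)⁻¹) U :=
      contDiffOn_const.mul ((hr.comp_contDiffOn (contDiffOn_const.mul R.smooth_h)).inv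
        fun x hx => by simpa using R.h_ne x hx)
    fin_cases i
    · exact contDiffOn_const
    · exact contDiffOn_const
    · exact e2
    · exact e3
  · intro x hx a b
    have h1 : (f x : ℂ) ≠ 0 := by exact_mod_cast R.f_ne x hx
    have h2 : (h x : ℂ) ≠ 0 := by exact_mod_cast R.h_ne x hx
    have hI := Complex.I_sq
    fin_cases a <;> fin_cases b <;>
      simp [Metric.inner, evalTensor, Tetrad.frame, rosenTetrad, rosenMetric, eta,
        Fin.sum_univ_four] <;>
      field_simp <;> simp [hI, Complex.conj_ofNat] <;> norm_num

theorem frame_weight (R : IsRosen U f h p q w v s r Λ) (a : Fin 4) :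
    ∑ i, (rosenTetrad f h).frame a x i * w i = w a ∧
      ∑ i, (rosenTetrad f h).frame a x i * v i = v a := by
  fin_cases a <;>
    simp [Tetrad.frame, rosenTetrad, Fin.sum_univ_four, R.w_eq, R.v_eq]

theorem dirDeriv_frame (R : IsRosen U f h p q w v s r Λ) (hx : x ∈ U) (a b i : Fin 4) :
    dirDeriv ((rosenTetrad f h).frame a x) (fun y => (rosenTetrad f h).frame b y i) x
      = -(![0, 0, w a * p x, v a * q x] : Fin 4 → ℂ) i * (rosenTetrad f h).frame b x i := by
  have key := dirDeriv_inv_two_mul R.isOpen hx R.smooth_f R.f_ne (R.deriv_f x hx)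
    ((rosenTetrad f h).frame a x)
  have key' := dirDeriv_inv_two_mul R.isOpen hx R.smooth_h R.h_ne (R.deriv_h x hx)
    ((rosenTetrad f h).frame a x)
  have hd : DifferentiableAt ℝ (fun y => ((2 * h y : ℝ) : ℂ)⁻¹) x :=
    (Complex.ofRealCLM.differentiableAt.comp x
      ((R.smooth_h.differentiableAt_real R.isOpen hx).const_mul 2)).inv (by
        simpa using R.h_ne x hx)
  rw [(R.frame_weight a).1] at key
  rw [(R.frame_weight a).2] at key'
  generalize (rosenTetrad f h).frame a x = u at key key' ⊢
  have e22 : (fun y => (rosenTetrad f h).frame 2 y 2) = fun y => ((2 * f y : ℝ) : ℂ)⁻¹ := rfl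
  have e23 : (fun y => (rosenTetrad f h).frame 2 y 3)
    = fun y => Complex.I * ((2 * h y : ℝ) : ℂ)⁻¹ := rfl
  have e32 : (fun y => (rosenTetrad f h).frame 3 y 2) = fun y => ((2 * f y : ℝ) : ℂ)⁻¹ :=
    funext fun y => by
      simp [Tetrad.frame, rosenTetrad, Complex.conj_ofNat]
  have e33 : (fun y => (rosenTetrad f h).frame 3 y 3)
      = fun y => -Complex.I * ((2 * h y : ℝ) : ℂ)⁻¹ :=
    funext fun y => by
      simp [Tetrad.frame, rosenTetrad, Complex.conj_ofNat]
  have e0 : ∀ i, (fun y => (rosenTetrad f h).frame 0 y i)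
    = fun _ => (((![1, 0, 0, 0] : Fin 4 → ℝ) i : ℝ) : ℂ) := fun i => rfl
  have e1 : ∀ i, (fun y => (rosenTetrad f h).frame 1 y i)
    = fun _ => (((![0, 1, 0, 0] : Fin 4 → ℝ) i : ℝ) : ℂ) := fun i => rfl
  have ec : ∀ (b i : Fin 4) (F : Point → ℂ), (fun y => (rosenTetrad f h).frame b y i) = F →
      dirDeriv u F x = -(![0, 0, w a * p x, v a * q x] : Fin 4 → ℂ) i * F x →
      dirDeriv u (fun y => (rosenTetrad f h).frame b y i) x
        = -(![0, 0, w a * p x, v a * q x] : Fin 4 → ℂ) i * (rosenTetrad f h).frame b x i := by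
    intro b i F hF hd
    rw [hF, hd, ← hF]
  have hb : b = 0 ∨ b = 1 ∨ b = 2 ∨ b = 3 := by fin_cases b <;> simp
  rcases hb with rfl | rfl | rfl | rfl
  · refine ec _ _ _ (e0 i) ?_
    rw [dirDeriv_const]
    fin_cases i <;> simp
  · refine ec _ _ _ (e1 i) ?_
    rw [dirDeriv_const]
    fin_cases i <;> simp
  · fin_cases i
    · exact ec _ _ (fun _ => 0) rfl (by simp [dirDeriv_const])
    · exact ec _ _ (fun _ => 0) rfl (by simp [dirDeriv_const])
    · exact ec _ _ _ e22 (by simpa using key)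
    · refine ec _ _ _ e23 ?_
      rw [dirDeriv_const_mul _ hd, key']
      change _ = -((v a : ℂ) * q x) * _
      ring
  · fin_cases i
    · exact ec _ _ (fun _ => 0) (funext fun y => map_zero _) (by simp [dirDeriv_const])
    · exact ec _ _ (fun _ => 0) (funext fun y => map_zero _) (by simp [dirDeriv_const])
    · exact ec _ _ _ e32 (by simpa using key)
    · refine ec _ _ _ e33 ?_
      rw [dirDeriv_const_mul _ hd, key']
      change _ = -((v a : ℂ) * q x) * _
      ring

theorem struct_eq (R : IsRosen U f h p q w v s r Λ) (hx : x ∈ U) (a b k : Fin 4) :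
    struct (rosenMetric f h) (rosenTetrad f h) a b k x
      = p x * (w a * rosenP b k - w b * rosenP a k)
        + q x * (v a * rosenQ b k - v b * rosenQ a k) := by
  have h1 : (f x : ℂ) ≠ 0 := by exact_mod_cast R.f_ne x hx
  have h2 : (h x : ℂ) ≠ 0 := by exact_mod_cast R.h_ne x hx
  have hI := Complex.I_sq
  have hP : ∀ b k, rosenP b k = 2 * (f x : ℂ) ^ 2 * (rosenTetrad f h).frame b x 2
      * (rosenTetrad f h).frame k x 2 := by
    intro b k
    fin_cases b <;> fin_cases k <;> simp [Tetrad.frame, rosenTetrad, rosenP, Complex.conj_ofNat] <;>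
      field_simp
  have hQ : ∀ b k, rosenQ b k = 2 * (h x : ℂ) ^ 2 * (rosenTetrad f h).frame b x 3
      * (rosenTetrad f h).frame k x 3 := by
    intro b k
    fin_cases b <;> fin_cases k <;> simp [Tetrad.frame, rosenTetrad, rosenQ, Complex.conj_ofNat] <;>
      field_simp <;> simp [hI]
  simp only [struct, Metric.inner, evalTensor, bracket, R.dirDeriv_frame hx, hP, hQ]
  simp [Fin.sum_univ_four, rosenMetric]
  ring

theorem rosenP_symm (a b : Fin 4) : rosenP a b = rosenP b a := by
  fin_cases a <;> fin_cases b <;> rfl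

theorem rosenQ_symm (a b : Fin 4) : rosenQ a b = rosenQ b a := by
  fin_cases a <;> fin_cases b <;> rfl

theorem conn_eq (R : IsRosen U f h p q w v s r Λ) (hx : x ∈ U) (a b k : Fin 4) :
    conn (rosenMetric f h) (rosenTetrad f h) a b k x
      = (w k * rosenP a b - w b * rosenP a k) * p x
        + (v k * rosenQ a b - v b * rosenQ a k) * q x := by
  simp only [conn, R.struct_eq hx]
  rw [rosenP_symm k a, rosenQ_symm k a, rosenP_symm b a, rosenQ_symm b a, rosenP_symm k b,
    rosenQ_symm k b]
  ring

theorem dirDeriv_conn (R : IsRosen U f h p q w v s r Λ) (hx : x ∈ U) (c a b k : Fin 4) :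
    dirDeriv ((rosenTetrad f h).frame c x) (conn (rosenMetric f h) (rosenTetrad f h) a b k) x
      = (w k * rosenP a b - w b * rosenP a k) * (w c * (s - p x ^ 2))
        + (v k * rosenQ a b - v b * rosenQ a k) * (v c * (r - q x ^ 2)) := by
  have hpd := R.smooth_p.differentiableAt_real R.isOpen hx
  have hqd := R.smooth_q.differentiableAt_real R.isOpen hx
  have hpc : DifferentiableAt ℝ (fun y => (p y : ℂ)) x :=
    Complex.ofRealCLM.differentiableAt.comp x hpd
  have hqc : DifferentiableAt ℝ (fun y => (q y : ℂ)) x :=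
    Complex.ofRealCLM.differentiableAt.comp x hqd
  have e1 : dirDeriv ((rosenTetrad f h).frame c x) (fun y => (p y : ℂ)) x
      = w c * (s - p x ^ 2) := by
    rw [dirDeriv_ofReal hpd, ← (R.frame_weight (x := x) c).1, Finset.sum_mul]
    exact Finset.sum_congr rfl fun i _ => by rw [R.deriv_p x hx]; push_cast; ring
  have e2 : dirDeriv ((rosenTetrad f h).frame c x) (fun y => (q y : ℂ)) x
      = v c * (r - q x ^ 2) := by
    rw [dirDeriv_ofReal hqd, ← (R.frame_weight (x := x) c).2, Finset.sum_mul]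
    exact Finset.sum_congr rfl fun i _ => by rw [R.deriv_q x hx]; push_cast; ring
  rw [dirDeriv_congr R.isOpen hx fun y hy => R.conn_eq hy a b k,
    dirDeriv_add (hpc.const_mul _) (hqc.const_mul _), dirDeriv_const_mul _ hpc,
    dirDeriv_const_mul _ hqc, e1, e2]

theorem vacuum (R : IsRosen U f h p q w v s r Λ) :
    IsVacuum (rosenMetric f h) (rosenTetrad f h) U Λ := by
  intro x hx a b
  obtain ⟨w2, w3⟩ := R.w_eq
  obtain ⟨v2, v3⟩ := R.v_eq
  have c1 : (s : ℂ) * w 0 ^ 2 + r * v 0 ^ 2 = 0 := by exact_mod_cast R.vac00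
  have c2 : (s : ℂ) * w 1 ^ 2 + r * v 1 ^ 2 = 0 := by exact_mod_cast R.vac11
  have c3 : (s : ℂ) * w 0 * w 1 = 3 * Λ := by exact_mod_cast R.vac_w
  have c4 : (r : ℂ) * v 0 * v 1 = 3 * Λ := by exact_mod_cast R.vac_v
  have c5 : (w 0 : ℂ) * v 1 + w 1 * v 0 = 0 := by exact_mod_cast R.vac_wv
  rw [IsReducedTetrad.ricci_eq]
  simp only [riemann_eq, eta_sum, R.dirDeriv_conn hx, R.conn_eq hx, R.struct_eq hx]
  fin_cases a <;> fin_cases b <;>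
    simp [rosenP, rosenQ, eta, w2, w3, v2, v3] <;> ring_nf
  · linear_combination c1
  · linear_combination c3 + c4
  · linear_combination c3 + c4
  · linear_combination c2
  · linear_combination c4 - c3
  · linear_combination -c3 - c4 - p x * q x * c5
  · linear_combination -c3 - c4 - p x * q x * c5
  · linear_combination c4 - c3

end IsRosen

namespace IsRosen

variable {U : Set Point} {f h p q : Point → ℝ} {w v : Fin 4 → ℝ} {s r Λ : ℝ} {x : Point}

theorem killing (R : IsRosen U f h p q w v s r Λ) :
    IsKillingTensor (rosenMetric f h) (rosenTetrad f h) U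
      (formK4 (rosenMetric f h) (rosenTetrad f h) (fun _ => 0) (fun x => (f x ^ 2 - h x ^ 2) / 2)
        (fun x => (f x ^ 2 + h x ^ 2) / 2)) := by
  intro x hx
  have hfd := R.smooth_f.differentiableAt_real R.isOpen hx
  have hhd := R.smooth_h.differentiableAt_real R.isOpen hx
  have hfc : DifferentiableAt ℝ (fun y => (f y : ℂ)) x :=
    Complex.ofRealCLM.differentiableAt.comp x hfd
  have hhc : DifferentiableAt ℝ (fun y => (h y : ℂ)) x :=
    Complex.ofRealCLM.differentiableAt.comp x hhd
  have ef : ∀ c, dirDeriv ((rosenTetrad f h).frame c x) (fun y => (f y : ℂ)) x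
      = w c * (p x * f x) := by
    intro c
    rw [dirDeriv_ofReal hfd, ← (R.frame_weight (x := x) c).1, Finset.sum_mul]
    exact Finset.sum_congr rfl fun i _ => by rw [R.deriv_f x hx]; push_cast; ring
  have eh : ∀ c, dirDeriv ((rosenTetrad f h).frame c x) (fun y => (h y : ℂ)) x
      = v c * (q x * h x) := by
    intro c
    rw [dirDeriv_ofReal hhd, ← (R.frame_weight (x := x) c).2, Finset.sum_mul]
    exact Finset.sum_congr rfl fun i _ => by rw [R.deriv_h x hx]; push_cast; ring
  have hK : ∀ a b (y : Point), frameK4 ((fun _ => (0 : ℝ)) y : ℝ)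
      ((fun x => (f x ^ 2 - h x ^ 2) / 2) y : ℝ) ((fun x => (f x ^ 2 + h x ^ 2) / 2) y : ℝ) a b
      = rosenP a b * ((f y : ℂ) * f y) - rosenQ a b * ((h y : ℂ) * h y) := by
    intro a b y
    fin_cases a <;> fin_cases b <;> simp [frameK4, rosenP, rosenQ] <;> ring
  have hd : ∀ c a b, dirDeriv ((rosenTetrad f h).frame c x)
      (fun y => frameK4 ((fun _ => (0 : ℝ)) y : ℝ) ((fun x => (f x ^ 2 - h x ^ 2) / 2) y : ℝ)
        ((fun x => (f x ^ 2 + h x ^ 2) / 2) y : ℝ) a b) x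
      = rosenP a b * (2 * (w c * p x * (f x : ℂ) ^ 2))
        - rosenQ a b * (2 * (v c * q x * (h x : ℂ) ^ 2)) := by
    intro c a b
    rw [dirDeriv_congr R.isOpen hx fun y _ => hK a b y,
      dirDeriv_sub ((hfc.fun_mul hfc).const_mul _) ((hhc.fun_mul hhc).const_mul _),
      dirDeriv_const_mul _ (hfc.fun_mul hfc), dirDeriv_const_mul _ (hhc.fun_mul hhc),
      dirDeriv_mul hfc hfc, dirDeriv_mul hhc hhc, ef, eh]
    ring
  obtain ⟨w2, w3⟩ := R.w_eq
  obtain ⟨v2, v3⟩ := R.v_eq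
  have hcov : ∀ c a b, covDeriv (rosenMetric f h) (rosenTetrad f h)
      (formK4 (rosenMetric f h) (rosenTetrad f h) (fun _ => 0) (fun x => (f x ^ 2 - h x ^ 2) / 2)
        (fun x => (f x ^ 2 + h x ^ 2) / 2)) c a b x
      = (2 * w c * rosenP a b - w a * rosenP c b - w b * rosenP c a) * (p x * (f x : ℂ) ^ 2)
        - (2 * v c * rosenQ a b - v a * rosenQ c b - v b * rosenQ c a)
          * (q x * (h x : ℂ) ^ 2) := by
    intro c a b
    rw [R.tetrad.covDeriv_formK4 R.isOpen hx, hd]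
    simp only [hK, eta_sum, R.conn_eq hx]
    fin_cases a <;> fin_cases b <;> fin_cases c <;>
      simp [rosenP, rosenQ, w2, w3, v2, v3] <;> ring
  refine ⟨?_, fun a b c => ?_⟩
  · ext i j
    simp only [Matrix.transpose_apply, formK4, Matrix.of_apply]
    ring
  · simp only [hcov]
    rw [rosenP_symm c b, rosenP_symm c a, rosenP_symm b a, rosenQ_symm c b, rosenQ_symm c a,
      rosenQ_symm b a]
    ring

theorem isK4Solution (R : IsRosen U f h p q w v s r Λ) :
    IsK4Solution U (rosenMetric f h) (rosenTetrad f h) Λ (fun _ => 0)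
      (fun x => (f x ^ 2 - h x ^ 2) / 2) (fun x => (f x ^ 2 + h x ^ 2) / 2) := by
  have := R.smooth_f
  have := R.smooth_h
  refine ⟨R.isOpen, R.tetrad, R.vacuum, contDiffOn_const, by fun_prop, by fun_prop, R.killing,
    fun x hx => ?_⟩
  have h1 : 0 < f x ^ 2 := sq_pos_of_ne_zero (R.f_ne x hx)
  have h2 : 0 < h x ^ 2 := sq_pos_of_ne_zero (R.h_ne x hx)
  refine ⟨fun h => ?_, fun h => ?_, fun h => ?_⟩ <;> linarith

theorem isAdaptedRotation (R : IsRosen U f h p q w v s r Λ) (k₁ k₂ k₇ : Point → ℝ) :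
    IsAdaptedRotation U (rosenMetric f h) (rosenTetrad f h) k₁ k₂ k₇ (fun _ => 0) (fun _ => 0)
      (fun _ => 0) := by
  have hT : (rosenTetrad f h).rotate (fun _ => 0) (fun _ => 0) (fun _ => 0) = rosenTetrad f h := by
    simp [Tetrad.rotate]
  have hA : ∀ x ∈ U, ∀ c, (1 / 2) * (conn (rosenMetric f h) (rosenTetrad f h) c 0 1 x
      - conn (rosenMetric f h) (rosenTetrad f h) c 2 3 x) = 0 := by
    intro x hx c
    rw [R.conn_eq hx, R.conn_eq hx]
    fin_cases c <;> simp [rosenP, rosenQ, R.w_eq, R.v_eq]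
  refine ⟨contDiffOn_const, contDiffOn_const, contDiffOn_const, fun x _ => by rw [hT], ?_, ?_, ?_,
    ?_⟩ <;> rw [hT]
  · exact fun x hx => hA x hx 0
  · exact fun x hx => hA x hx 1
  · exact fun x hx => hA x hx 3
  · exact fun x hx => hA x hx 2

theorem rho_eq (R : IsRosen U f h p q w v s r Λ) (hx : x ∈ U) :
    rho (rosenMetric f h) (rosenTetrad f h) x
      = ((-(w 0 * p x + v 0 * q x) / 2 : ℝ) : ℂ) := by
  rw [rho, R.conn_eq hx]
  simp [rosenP, rosenQ]
  ring

theorem sigma_eq (R : IsRosen U f h p q w v s r Λ) (hx : x ∈ U) :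
    sigma (rosenMetric f h) (rosenTetrad f h) x
      = ((-(w 0 * p x - v 0 * q x) / 2 : ℝ) : ℂ) := by
  rw [sigma, R.conn_eq hx]
  simp [rosenP, rosenQ]
  ring

theorem mu_eq (R : IsRosen U f h p q w v s r Λ) (hx : x ∈ U) :
    mu (rosenMetric f h) (rosenTetrad f h) x = (((w 1 * p x + v 1 * q x) / 2 : ℝ) : ℂ) := by
  rw [mu, R.conn_eq hx]
  simp [rosenP, rosenQ]
  ring

theorem isClassI (R : IsRosen U f h p q w v s r Λ) (hρ : ∀ x ∈ U, w 0 * p x + v 0 * q x ≠ 0) :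
    IsClassI U (rosenMetric f h) (rosenTetrad f h) := by
  intro x hx
  rw [R.rho_eq hx, pi, R.conn_eq hx]
  refine ⟨?_, by simp [rosenP, rosenQ, R.w_eq, R.v_eq]⟩
  have := hρ x hx
  exact_mod_cast div_ne_zero (neg_ne_zero.2 this) two_ne_zero

theorem psi0_eq (R : IsRosen U f h p q w v s r Λ) (hρ : ∀ x ∈ U, w 0 * p x + v 0 * q x ≠ 0)
    (hx : x ∈ U) : psi0 (rosenMetric f h) (rosenTetrad f h) x
      = (1 / 2) * (r * v 0 ^ 2 - s * w 0 ^ 2) := by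
  have hred := (R.isK4Solution.isReducedTetrad (R.isAdaptedRotation _ _ _) (R.isClassI hρ)).2
  obtain ⟨-, e, -⟩ := hred.derivative_equations hx
  rw [R.dirDeriv_conn hx] at e
  simp only [R.conn_eq hx] at e
  simp [rosenP, rosenQ, R.w_eq, R.v_eq] at e
  linear_combination -e

end IsRosen

theorem fderiv_profile {G : ℝ → ℝ} {G' α β : ℝ} {x : Point}
    (hG : HasDerivAt G G' (α * x 0 + β * x 1)) (i : Fin 4) :
    fderiv ℝ (fun y : Point => G (α * y 0 + β * y 1)) x (Pi.single i 1)
      = (![α, β, 0, 0] : Fin 4 → ℝ) i * G' := by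
  have h0 : HasFDerivAt (fun y : Point => α * y 0 + β * y 1)
      (α • ContinuousLinearMap.proj (R := ℝ) (φ := fun _ : Fin 4 => ℝ) 0
        + β • ContinuousLinearMap.proj (R := ℝ) (φ := fun _ : Fin 4 => ℝ) 1) x :=
    ((hasFDerivAt_apply 0 x).const_mul α).add ((hasFDerivAt_apply 1 x).const_mul β)
  have h1 : HasFDerivAt (fun y : Point => G (α * y 0 + β * y 1)) _ x :=
    hG.comp_hasFDerivAt x h0
  rw [h1.fderiv]
  fin_cases i <;> simp [mul_comm]

theorem hasDerivAt_neg_tan {t : ℝ} (ht : Real.cos t ≠ 0) :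
    HasDerivAt (fun t => -(Real.sin t / Real.cos t)) (-1 - (-(Real.sin t / Real.cos t)) ^ 2) t := by
  refine ((Real.hasDerivAt_sin t).div (Real.hasDerivAt_cos t) ht).neg.congr_deriv ?_
  field_simp
  ring

theorem hasDerivAt_sinh_div_cosh (t : ℝ) :
    HasDerivAt (fun t => Real.sinh t / Real.cosh t) (1 - (Real.sinh t / Real.cosh t) ^ 2) t := by
  have ht : Real.cosh t ≠ 0 := (Real.cosh_pos t).ne'
  refine ((Real.hasDerivAt_sinh t).div (Real.hasDerivAt_cosh t) ht).congr_deriv ?_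
  field_simp

theorem hasDerivAt_cos_eq_tan_mul {t : ℝ} (ht : Real.cos t ≠ 0) :
    HasDerivAt Real.cos (-(Real.sin t / Real.cos t) * Real.cos t) t := by
  convert Real.hasDerivAt_cos t using 1
  field_simp

/-- The domain where the plane wave is regular, with `ρ ≠ 0 ≠ σ`. -/
def planeWaveDomain : Set Point :=
  {x | Real.cos (1 * x 0 + 0 * x 1) ≠ 0 ∧
      -(Real.sin (1 * x 0 + 0 * x 1) / Real.cos (1 * x 0 + 0 * x 1))
        + Real.sinh (1 * x 0 + 0 * x 1) / Real.cosh (1 * x 0 + 0 * x 1) ≠ 0 ∧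
      -(Real.sin (1 * x 0 + 0 * x 1) / Real.cos (1 * x 0 + 0 * x 1))
        - Real.sinh (1 * x 0 + 0 * x 1) / Real.cosh (1 * x 0 + 0 * x 1) ≠ 0}

/-- A plane wave: `f = cos x⁰`, `h = cosh x⁰`. -/
theorem isRosen_planeWave : IsRosen planeWaveDomain
    (fun x => Real.cos (1 * x 0 + 0 * x 1)) (fun x => Real.cosh (1 * x 0 + 0 * x 1))
    (fun x => -(Real.sin (1 * x 0 + 0 * x 1) / Real.cos (1 * x 0 + 0 * x 1)))
    (fun x => Real.sinh (1 * x 0 + 0 * x 1) / Real.cosh (1 * x 0 + 0 * x 1))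
    ![1, 0, 0, 0] ![1, 0, 0, 0] (-1) 1 0 := by
  have hc : ∀ t, Real.cosh t ≠ 0 := fun t => (Real.cosh_pos t).ne'
  refine
    { isOpen := ?_
      smooth_f := (by fun_prop : ContDiff ℝ ∞ _).contDiffOn
      smooth_h := (by fun_prop : ContDiff ℝ ∞ _).contDiffOn
      smooth_p := ?_
      smooth_q := ?_
      f_ne := fun x hx => hx.1
      h_ne := fun x _ => hc _
      deriv_f := fun x hx i => ?_
      deriv_h := fun x hx i => ?_
      deriv_p := fun x hx i => fderiv_profile (hasDerivAt_neg_tan hx.1) i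
      deriv_q := fun x hx i => fderiv_profile (hasDerivAt_sinh_div_cosh _) i
      w_eq := ⟨rfl, rfl⟩
      v_eq := ⟨rfl, rfl⟩
      vac00 := by simp
      vac11 := by simp
      vac_w := by simp
      vac_v := by simp
      vac_wv := by simp }
  · have h1 : IsOpen {x : Point | Real.cos (1 * x 0 + 0 * x 1) ≠ 0} :=
      isOpen_ne_fun (by fun_prop) continuous_const
    have hp : ContinuousOn (fun x : Point =>
        -(Real.sin (1 * x 0 + 0 * x 1) / Real.cos (1 * x 0 + 0 * x 1)))
        {x : Point | Real.cos (1 * x 0 + 0 * x 1) ≠ 0} :=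
      (ContinuousOn.div (by fun_prop) (by fun_prop) fun x hx => hx).neg
    have hq : Continuous (fun x : Point =>
        Real.sinh (1 * x 0 + 0 * x 1) / Real.cosh (1 * x 0 + 0 * x 1)) :=
      Continuous.div (by fun_prop) (by fun_prop) fun x => hc _
    have h2 := (hp.add hq.continuousOn).isOpen_inter_preimage h1 isOpen_compl_singleton (t := {0}ᶜ)
    have h3 := (hp.sub hq.continuousOn).isOpen_inter_preimage h1 isOpen_compl_singleton (t := {0}ᶜ)
    convert h2.inter h3 using 1
    ext x
    simp only [Set.mem_ofPred_eq, planeWaveDomain, Set.mem_inter_iff, Set.mem_preimage,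
      Set.mem_compl_iff, Set.mem_singleton_iff, Pi.add_apply, Pi.sub_apply, ne_eq]
    tauto
  · exact (ContDiffOn.div (by fun_prop) (by fun_prop) fun x hx => hx.1).neg
  · exact ContDiffOn.div (by fun_prop) (by fun_prop) fun x _ => hc _
  · rw [fderiv_profile (hasDerivAt_cos_eq_tan_mul hx.1), mul_assoc]
  · have : HasDerivAt Real.cosh (Real.sinh (1 * x 0 + 0 * x 1) / Real.cosh (1 * x 0 + 0 * x 1)
        * Real.cosh (1 * x 0 + 0 * x 1)) (1 * x 0 + 0 * x 1) :=
      (Real.hasDerivAt_cosh _).congr_deriv (div_mul_cancel₀ _ (hc _)).symm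
    rw [fderiv_profile this, mul_assoc]

/-- The domain where the Nariai spacetime is regular in these coordinates, with `ρ ≠ 0 ≠ σ`. -/
def nariaiDomain : Set Point :=
  {x | Real.cos (1 * x 0 + -1 * x 1) ≠ 0 ∧
      Real.cos (1 * x 0 + -1 * x 1) - Real.sin (1 * x 0 + -1 * x 1) ≠ 0 ∧
      Real.cos (1 * x 0 + -1 * x 1) + Real.sin (1 * x 0 + -1 * x 1) ≠ 0}

/-- The product of the de Sitter plane and the sphere: `f = exp (x⁰ + x¹)`, `h = cos (x⁰ - x¹)`. -/
theorem isRosen_nariai : IsRosen nariaiDomain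
    (fun x => Real.exp (1 * x 0 + 1 * x 1)) (fun x => Real.cos (1 * x 0 + -1 * x 1))
    (fun _ => 1)
    (fun x => -(Real.sin (1 * x 0 + -1 * x 1) / Real.cos (1 * x 0 + -1 * x 1)))
    ![1, 1, 0, 0] ![1, -1, 0, 0] 1 (-1) (1 / 3) := by
  refine
    { isOpen := ?_
      smooth_f := (by fun_prop : ContDiff ℝ ∞ _).contDiffOn
      smooth_h := (by fun_prop : ContDiff ℝ ∞ _).contDiffOn
      smooth_p := contDiffOn_const
      smooth_q := ?_
      f_ne := fun x _ => (Real.exp_pos _).ne'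
      h_ne := fun x hx => hx.1
      deriv_f := fun x hx i => ?_
      deriv_h := fun x hx i => ?_
      deriv_p := fun x hx i => by simp
      deriv_q := fun x hx i => fderiv_profile (hasDerivAt_neg_tan hx.1) i
      w_eq := ⟨rfl, rfl⟩
      v_eq := ⟨rfl, rfl⟩
      vac00 := by simp
      vac11 := by simp
      vac_w := by simp
      vac_v := by simp
      vac_wv := by simp }
  · exact (isOpen_ne_fun (by fun_prop) continuous_const).inter
      ((isOpen_ne_fun (by fun_prop) continuous_const).inter
        (isOpen_ne_fun (by fun_prop) continuous_const))
  · exact (ContDiffOn.div (by fun_prop) (by fun_prop) fun x hx => hx.1).neg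
  · rw [fderiv_profile (Real.hasDerivAt_exp _), mul_one]
  · rw [fderiv_profile (hasDerivAt_cos_eq_tan_mul hx.1), mul_assoc]

theorem exists_classI_petrovN :
    ∃ (U : Set Point) (g : Metric) (T : Tetrad) (Λ : ℝ) (k₁ k₂ k₇ : Point → ℝ)
        (a b : Point → ℝ) (p : Point → ℂ),
      U.Nonempty ∧ IsK4Solution U g T Λ k₁ k₂ k₇ ∧
      IsAdaptedRotation U g T k₁ k₂ k₇ a b p ∧ IsClassI U g T ∧
      ∀ x ∈ U, IsPetrovN g T x ∧ mu g T x = 0 ∧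
        kappa g T x = 0 ∧ sigma g T x ≠ 0 ∧ (rho g T x).re ≠ 0 := by
  have R := isRosen_planeWave
  have hC := R.isClassI fun x hx => by simpa using hx.2.1
  refine ⟨planeWaveDomain, _, _, _, _, _, _, _, _, _, ⟨fun _ => Real.pi / 4, ?_⟩, R.isK4Solution,
    R.isAdaptedRotation _ _ _, hC, fun x hx => ?_⟩
  · have h0 : (0 : ℝ) < Real.sqrt 2 / 2 := by positivity
    have hc := Real.cosh_pos (Real.pi / 4)
    have hs : 0 < Real.sinh (Real.pi / 4) := Real.sinh_pos_iff.2 (by positivity)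
    have hlt := Real.sinh_lt_cosh (Real.pi / 4)
    have h1 : Real.sinh (Real.pi / 4) / Real.cosh (Real.pi / 4) < 1 := (div_lt_one hc).2 hlt
    have h2 := div_pos hs hc
    have e : 1 * (Real.pi / 4) + 0 * (Real.pi / 4) = Real.pi / 4 := by ring
    simp only [planeWaveDomain, Set.mem_ofPred_eq, e, Real.cos_pi_div_four, Real.sin_pi_div_four,
      div_self h0.ne']
    refine ⟨h0.ne', ?_, ?_⟩ <;> linarith
  · obtain ⟨-, hcommon, hN, -⟩ := R.isK4Solution.classI (R.isAdaptedRotation _ _ _) hC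
    have hmu : ∀ y ∈ planeWaveDomain, mu _ _ y = 0 := fun y hy => by
      rw [R.mu_eq hy]
      simp
    refine ⟨(hN x hx (Filter.eventually_of_mem (R.isOpen.mem_nhds hx) hmu)).2.2.2.2 fun hO => ?_,
      hmu x hx, (hcommon x hx).1, ?_, ?_⟩
    · have h10 := hO 1 0
      simp only [weylQuartic, R.psi0_eq (fun x hx => by simpa using hx.2.1) hx] at h10
      norm_num at h10
    · rw [R.sigma_eq hx, Complex.ofReal_ne_zero]
      have h2 := hx.2.2
      contrapose! h2
      simp only [Matrix.cons_val] at h2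
      linear_combination -2 * h2
    · rw [R.rho_eq hx, Complex.ofReal_re]
      have h1 := hx.2.1
      contrapose! h1
      simp only [Matrix.cons_val] at h1
      linear_combination -2 * h1

theorem exists_classI_petrovD :
    ∃ (U : Set Point) (g : Metric) (T : Tetrad) (Λ : ℝ) (k₁ k₂ k₇ : Point → ℝ)
        (a b : Point → ℝ) (p : Point → ℂ),
      U.Nonempty ∧ IsK4Solution U g T Λ k₁ k₂ k₇ ∧
      IsAdaptedRotation U g T k₁ k₂ k₇ a b p ∧ IsClassI U g T ∧
      ∀ x ∈ U, IsPetrovD g T x ∧ psi0 g T x * psi4 g T x = (3 * psi2 g T x) ^ 2 ∧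
        mu g T x ≠ 0 ∧ tau g T x = 0 ∧
        kappa g T x = 0 ∧ sigma g T x ≠ 0 ∧ (rho g T x).re ≠ 0 := by
  have R := isRosen_nariai
  have hdiv : ∀ x ∈ nariaiDomain,
      1 - Real.sin (1 * x 0 + -1 * x 1) / Real.cos (1 * x 0 + -1 * x 1) ≠ 0 ∧
      1 + Real.sin (1 * x 0 + -1 * x 1) / Real.cos (1 * x 0 + -1 * x 1) ≠ 0 := by
    intro x hx
    have h1 := div_ne_zero hx.2.1 hx.1
    have h2 := div_ne_zero hx.2.2 hx.1
    rw [sub_div, div_self hx.1] at h1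
    rw [add_div, div_self hx.1] at h2
    exact ⟨h1, h2⟩
  have hC := R.isClassI fun x hx => by
    have h := (hdiv x hx).1
    contrapose! h
    simp only [Matrix.cons_val] at h
    linear_combination h
  refine ⟨nariaiDomain, _, _, _, _, _, _, _, _, _, ⟨fun _ => 0, ?_⟩, R.isK4Solution,
    R.isAdaptedRotation _ _ _, hC, fun x hx => ?_⟩
  · simp [nariaiDomain]
  · obtain ⟨-, hcommon, -, hD, -⟩ := R.isK4Solution.classI (R.isAdaptedRotation _ _ _) hC
    obtain ⟨h1, h2⟩ := hdiv x hx
    have hmu := (R.mu_eq hx).trans_ne (Complex.ofReal_ne_zero.2 (by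
      contrapose! h2
      simp only [Matrix.cons_val] at h2
      linear_combination 2 * h2))
    obtain ⟨hτ, hσ, hr, hPD⟩ := hD x hx hmu
    refine ⟨hPD fun hO => ?_, hr, hmu, hτ, (hcommon x hx).1, hσ, ?_⟩
    · have p2 := (hcommon x hx).2.2.2.2.1
      have h11 := hO 1 1
      have h12 := hO 1 (-1)
      have h10 := hO 1 0
      have h01 := hO 0 1
      simp only [weylQuartic, p2] at h11 h12 h10 h01
      have : (4 : ℂ) = 0 := by
        push_cast at h11 h12 h10 h01
        linear_combination h11 + h12 - 2 * h10 - 2 * h01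
      norm_num at this
    · rw [R.rho_eq hx, Complex.ofReal_re]
      contrapose! h1
      simp only [Matrix.cons_val] at h1
      linear_combination -2 * h1

end NewmanPenrose

theorem theorem5 :
    -- every solution of Class I
    (∀ (U : Set Point) (g : Metric) (T : Tetrad) (Λ : ℝ) (k₁ k₂ k₇ : Point → ℝ)
        (a b : Point → ℝ) (p : Point → ℂ),
      IsK4Solution U g T Λ k₁ k₂ k₇ →
      IsAdaptedRotation U g T k₁ k₂ k₇ a b p →
      IsClassI U g T →
      -- the rotation is a boost, up to the sign of `m`
      (∀ x ∈ U, p x = 0 ∧ Real.sin (b x) = 0) ∧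
      -- geodesic congruences, and the relations common to all cases
      (∀ x ∈ U, kappa g T x = 0 ∧ nu g T x = 0 ∧
        psi1 g T x = 0 ∧ psi3 g T x = 0 ∧ psi2 g T x = (Λ : ℂ) ∧
        mu g T x * rho g T x = sigma g T x * lambda g T x ∧
        mu g T x * tau g T x = 0) ∧
      -- the cases with `μ = 0`: type N
      (∀ x ∈ U, (∀ᶠ y in 𝓝 x, mu g T y = 0) →
        lambda g T x = 0 ∧ psi2 g T x = 0 ∧ psi4 g T x = 0 ∧ Λ = 0 ∧
        (¬ IsPetrovO g T x → IsPetrovN g T x)) ∧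
      -- the case `μ ≠ 0 = τ`: type D
      (∀ x ∈ U, mu g T x ≠ 0 →
        tau g T x = 0 ∧ sigma g T x ≠ 0 ∧
        psi0 g T x * psi4 g T x = (3 * psi2 g T x) ^ 2 ∧
        (¬ IsPetrovO g T x → IsPetrovD g T x)) ∧
      -- wherever it is not conformally flat, the solution is of type N or D and `l` is shearing
      (∀ x ∈ U, ¬ IsPetrovO g T x →
        (IsPetrovN g T x ∨
          (IsPetrovD g T x ∧ psi0 g T x * psi4 g T x = (3 * psi2 g T x) ^ 2)) ∧
        ∃ᶠ y in 𝓝 x, sigma g T y ≠ 0)) ∧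
    -- a solution of type N exists in Class I
    (∃ (U : Set Point) (g : Metric) (T : Tetrad) (Λ : ℝ) (k₁ k₂ k₇ : Point → ℝ)
        (a b : Point → ℝ) (p : Point → ℂ),
      U.Nonempty ∧ IsK4Solution U g T Λ k₁ k₂ k₇ ∧
      IsAdaptedRotation U g T k₁ k₂ k₇ a b p ∧ IsClassI U g T ∧
      ∀ x ∈ U, IsPetrovN g T x ∧ mu g T x = 0 ∧
        kappa g T x = 0 ∧ sigma g T x ≠ 0 ∧ (rho g T x).re ≠ 0) ∧
    -- a solution of type D exists in Class I
    (∃ (U : Set Point) (g : Metric) (T : Tetrad) (Λ : ℝ) (k₁ k₂ k₇ : Point → ℝ)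
        (a b : Point → ℝ) (p : Point → ℂ),
      U.Nonempty ∧ IsK4Solution U g T Λ k₁ k₂ k₇ ∧
      IsAdaptedRotation U g T k₁ k₂ k₇ a b p ∧ IsClassI U g T ∧
      ∀ x ∈ U, IsPetrovD g T x ∧ psi0 g T x * psi4 g T x = (3 * psi2 g T x) ^ 2 ∧
        mu g T x ≠ 0 ∧ tau g T x = 0 ∧
        kappa g T x = 0 ∧ sigma g T x ≠ 0 ∧ (rho g T x).re ≠ 0) :=
  ⟨fun _ _ _ _ _ _ _ _ _ _ hS hR hC => hS.classI hR hC, exists_classI_petrovN,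
    exists_classI_petrovD⟩
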